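/- Let $\mathcal M$ be the set of finite Borel measures on $\mathbb R$ of constant sign (positive or negative), with all moments finite and with infinite support. Let $\sigma_1,\sigma_2\in\mathcal M$ with $\operatorname{supp}\sigma_j\subseteq\Gamma_j$, where $\Gamma_1,\Gamma_2\subseteq\mathbb R$ are closed intervals (possibly unbounded) with disjoint interiors, and let $\mu_1=\sigma_1$ and $d\mu_2(x)=m_{\sigma_2}(x)\,d\sigma_1(x)$ with $m_{\sigma_2}(x)=\int\frac{d\sigma_2(t)}{t-x}$; if $\Gamma_1$ and $\Gamma_2$ share an endpoint, it is assumed that the last formula defines a finite measure. In other words, $(\mu_1,\mu_2)=\mathcal N(\sigma_1,\sigma_2)$ is a Nikishin system. For $n=(n_1,n_2)\in\mathbb N^2$, $\mathbb N=\{0,1,2,\dots\}$, $n\neq(0,0)$, the type I multiple orthogonal polynomials $A_n=(A_n^{(1)},A_n^{(2)})$ are the real polynomials with $\deg A_n^{(j)}\le n_j-1$ (so $A_n^{(j)}=0$ if $n_j=0$) and $$\sum_{j=1}^2\int A_n^{(j)}(x)\,x^k\,d\mu_j(x)=\begin{cases}0,&0\le k\le n_1+n_2-2,\\ 1,&k=n_1+n_2-1.\end{cases}$$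 Two real polynomials interlace if all their complex zeros are real and simple, they have no common zero, and strictly between any two consecutive zeros of either one there lies exactly one zero of the other. (So the zero polynomial interlaces with no polynomial.) Let $e_1=(1,0)$ and $e_2=(0,1)$. Then $A_n$ exists and is unique for every $n\in\mathbb N^2$, $n\ne(0,0)$, and for every $n\in\mathbb N^2$ the following hold. (i) If $n_1+1\le n_2$, then $A_n^{(1)}$, $A_{n-e_1}^{(1)}$, $A_{n-e_2}^{(1)}$ are pairwise interlacing. (ii) If $n_1+1\ge n_2$, then $A_n^{(2)}$, $A_{n-e_1}^{(2)}$, $A_{n-e_2}^{(2)}$ are pairwise interlacing. Here, in part ($i$), $i\in\{1,2\}$, only those among the indices $k\in\{n,\,n-e_1,\,n-e_2\}$ are considered that lie in $\mathbb N^2$ and have $k_i\ge1$; for the other ones the polynomial $A_k^{(i)}$ is undefined or identically zero. -/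

import Mathlib

open MeasureTheory Set
open scoped Polynomial

noncomputable section

/-- A finite Borel measure on `ℝ` of constant sign, with all moments finite and with infinite
support. The measure is `sign • abs`, where `abs` is a positive measure and `sign` is `1` or `-1`.
(As the support is infinite, the measure is not zero, so `sign` and `abs` are determined by it.) -/
structure ConstSignMeasure where
  sign : ℤˣ
  abs : Measure ℝ
  isFiniteMeasure : IsFiniteMeasure abs
  integrable_pow : ∀ k : ℕ, Integrable (fun x : ℝ => x ^ k) abs
  infinite_support : abs.support.Infinite

namespace ConstSignMeasure

/-- The support of the measure. -/
def support (σ : ConstSignMeasure) : Set ℝ := σ.abs.support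

/-- The integral `∫ f dσ` over `ℝ`. -/
def integral (σ : ConstSignMeasure) (f : ℝ → ℝ) : ℝ :=
  ((σ.sign : ℤ) : ℝ) * ∫ x, f x ∂σ.abs

/-- The integral `∫_B f dσ` over a set `B`. -/
def setIntegral (σ : ConstSignMeasure) (B : Set ℝ) (f : ℝ → ℝ) : ℝ :=
  ((σ.sign : ℤ) : ℝ) * ∫ x in B, f x ∂σ.abs

/-- The value `σ(B)` of the measure on a set `B`. -/
def value (σ : ConstSignMeasure) (B : Set ℝ) : ℝ :=
  ((σ.sign : ℤ) : ℝ) * σ.abs.real B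

/-- The `m`-function `m_σ(x) = ∫ dσ(t) / (t - x)` at real points. -/
def mFunction (σ : ConstSignMeasure) (x : ℝ) : ℝ :=
  σ.integral fun t => (t - x)⁻¹

/-- The integral `∫ dσ(t) / (t - x)` that defines `m_σ(x)` converges absolutely. The first
condition says that `x` is not an atom; there the integrand would be infinite. -/
def MFunctionConverges (σ : ConstSignMeasure) (x : ℝ) : Prop :=
  σ.abs {x} = 0 ∧ Integrable (fun t : ℝ => (t - x)⁻¹) σ.abs

/-- `μ = ⟨σ, τ⟩`, that is, `dμ(x) = m_τ(x) dσ(x)`: the right-hand side defines a finite measure,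
and that measure is `μ`. -/
def IsBracket (μ σ τ : ConstSignMeasure) : Prop :=
  (∀ᵐ x ∂σ.abs, τ.MFunctionConverges x) ∧
  Integrable τ.mFunction σ.abs ∧
  ∀ B : Set ℝ, MeasurableSet B → μ.value B = σ.setIntegral B τ.mFunction

end ConstSignMeasure

/-- `(μ₁, μ₂) = N(σ₁, σ₂)`: the pair `μ` is the Nikishin system generated by the pair `σ`. The
closed intervals `Γ₁`, `Γ₂` may be unbounded and may share an endpoint. -/
def IsNikishinSystem (μ σ : Fin 2 → ConstSignMeasure) : Prop :=
  ∃ Γ : Fin 2 → Set ℝ,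
    (∀ j, IsClosed (Γ j) ∧ (Γ j).OrdConnected) ∧
    interior (Γ 0) ∩ interior (Γ 1) = ∅ ∧
    (∀ j, (σ j).support ⊆ Γ j) ∧
    μ 0 = σ 0 ∧
    (μ 1).IsBracket (σ 0) (σ 1)

/-- `A` is a type I multiple orthogonal polynomial (vector) at the multi-index `n` for the system
`μ`. The condition `degree < n j` means `deg A j ≤ n j - 1`, and `A j = 0` if `n j = 0`. -/
def IsTypeI {r : ℕ} (μ : Fin r → ConstSignMeasure) (n : Fin r → ℕ) (A : Fin r → ℝ[X]) : Prop :=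
  A ≠ 0 ∧
  (∀ j, (A j).degree < (n j : WithBot ℕ)) ∧
  (∀ k : ℕ, k + 1 < ∑ j, n j → ∑ j, (μ j).integral (fun x => (A j).eval x * x ^ k) = 0) ∧
  (∀ k : ℕ, k + 1 = ∑ j, n j → ∑ j, (μ j).integral (fun x => (A j).eval x * x ^ k) = 1)

/-- All zeros of the real polynomial `p` in `ℂ` are real, and they are simple. (The zero polynomial
does not have this property.) -/
def HasRealSimpleZeros (p : ℝ[X]) : Prop :=
  (∀ z : ℂ, Polynomial.aeval z p = 0 → z.im = 0) ∧
  ∀ x : ℝ, p.IsRoot x → p.rootMultiplicity x = 1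

/-- Between every two consecutive real zeros of `p` there lies exactly one zero of `q`. -/
def OneZeroBetween (p q : ℝ[X]) : Prop :=
  ∀ x y : ℝ, x < y → p.IsRoot x → p.IsRoot y → (∀ t ∈ Ioo x y, ¬ p.IsRoot t) →
    ∃! t : ℝ, t ∈ Ioo x y ∧ q.IsRoot t

/-- The zeros of `p` and `q` (strictly) interlace. -/
def Interlace (p q : ℝ[X]) : Prop :=
  HasRealSimpleZeros p ∧ HasRealSimpleZeros q ∧
  (∀ x : ℝ, ¬ (p.IsRoot x ∧ q.IsRoot x)) ∧
  OneZeroBetween p q ∧ OneZeroBetween q p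

/-- The indices among `n`, `n - e₁`, …, `n - e_r` that have non-negative entries. -/
def lowerNeighbours {r : ℕ} (n : Fin r → ℕ) : Set (Fin r → ℕ) :=
  {k | k = n ∨ ∃ j, k + Pi.single j 1 = n}

/-- The `i`-th components of the type I polynomials at `n`, `n - e₁`, …, `n - e_r` interlace
pairwise. The indices `k` with `k i = 0` are left out: there the `i`-th component vanishes
identically. -/
def TypeIPairwiseInterlace {r : ℕ} (μ : Fin r → ConstSignMeasure) (n : Fin r → ℕ) (i : Fin r) :
    Prop :=
  ∀ k ∈ lowerNeighbours n, ∀ l ∈ lowerNeighbours n, k ≠ l → k i ≠ 0 → l i ≠ 0 →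
    ∀ A B : Fin r → ℝ[X], IsTypeI μ k A → IsTypeI μ l B → Interlace (A i) (B i)

end

/-! Let `G` be a nontrivial real linear combination of two of the type I vectors at `n`, `n - e₁`,
`n - e₂`. Its components have degree below `n j`, and its first `|n| - 2` moments vanish. By
orthogonality, `G 0 + G 1 * m` with `m = m_{σ₂}` has at least `|n| - 2` zeros `Y` in the first
interval (`exists_zeros`).

Divided differences at `Y` carry these zeros to the second interval. For a polynomial `q` of degree
below `|Y|`, the divided difference of `q m` is up to sign `∫ q / ω_Y dσ₂`, where `ω_Y` is the nodal
polynomial; hence it is of one sign for nonnegative `q` (`StieltjesPos`). Choosing `q` as `G 1`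
times the nodal polynomial of its sign changes shows that `G 1` changes sign at least `n 1 - 2`
times inside the second interval (`StieltjesPos.exists_isSignSet`). Since its degree is at most `n 1
- 1`, only one zero is left over, and all zeros are real and simple
(`IsSignSet.hasRealSimpleZeros`).

For `G 0` one divides by `m`: `1 / m = ℓ + m'` with `deg ℓ ≤ 1` and `m'` again of Stieltjes type, so
`G 1 + G 0 / m = (G 1 + ℓ G 0) + G 0 m'`. Only finitely many points matter, so this is proved on
finite sets (`StieltjesLike.exists_inv`): Gauss quadrature replaces `m` by the transform of a
discrete measure, whose reciprocal is found by partial fractions.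

Finally, if every nontrivial combination of two polynomials has simple zeros, their Wronskian has no
zero, and Rolle's theorem for the quotient gives interlacing (`interlace_of_forall_combination`).
The same zero count gives existence and uniqueness of the type I vectors. -/

/-! ### Sign changes of functions on subsets of the line -/

/-- `S` is a finite set of zeros of `F` in `I` at which `F` changes its sign, and `F` does not
change its sign elsewhere on `I`. -/
def IsSignSet (I : Set ℝ) (F : ℝ → ℝ) (S : Finset ℝ) : Prop :=
  (S : Set ℝ) ⊆ I ∧ (∀ s ∈ S, F s = 0) ∧
    ∃ ε : ℝ, (ε = 1 ∨ ε = -1) ∧ ∀ x ∈ I, 0 ≤ ε * (F x * ∏ s ∈ S, (x - s))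

/-- The intermediate value property for the value zero, on a set `I` that need not be an
interval. -/
def HasZeroBetween (I : Set ℝ) (F : ℝ → ℝ) : Prop :=
  ∀ x ∈ I, ∀ y ∈ I, x < y → F x * F y < 0 → ∃ z ∈ I, x < z ∧ z < y ∧ F z = 0

theorem HasZeroBetween.exists_sign {I : Set ℝ} {F : ℝ → ℝ} (hF : HasZeroBetween I F)
    (h0 : ∀ x ∈ I, F x ≠ 0) : ∃ ε : ℝ, (ε = 1 ∨ ε = -1) ∧ ∀ x ∈ I, 0 ≤ ε * F x := by
  by_cases h : ∃ x ∈ I, F x < 0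
  · obtain ⟨x, hx, hx0⟩ := h
    refine ⟨-1, Or.inr rfl, fun y hy => ?_⟩
    by_contra! hc
    have hy0 : 0 < F y := by linarith
    rcases lt_trichotomy x y with hxy | rfl | hxy
    · obtain ⟨z, hz, -, -, hz0⟩ := hF x hx y hy hxy (mul_neg_of_neg_of_pos hx0 hy0)
      exact h0 z hz hz0
    · linarith
    · obtain ⟨z, hz, -, -, hz0⟩ := hF y hy x hx hxy (mul_neg_of_pos_of_neg hy0 hx0)
      exact h0 z hz hz0
  · push Not at h
    exact ⟨1, Or.inl rfl, fun y hy => by linarith [h y hy]⟩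

/-- Induction on the largest candidate zero `a`. To the right of `a` the function has one sign, to
the left the induction hypothesis applies, and `a` joins the set exactly when the two signs differ.
The set `I` is quantified after `Z` because the induction passes to `I ∩ Iio a`. -/
theorem HasZeroBetween.exists_isSignSet_of_zeros (F : ℝ → ℝ) (Z : Finset ℝ) :
    ∀ I : Set ℝ, HasZeroBetween I F → (∀ x ∈ I, F x = 0 → x ∈ Z) → ∃ S, IsSignSet I F S := by
  induction Z using Finset.induction_on_max with
  | empty =>
    intro I hF h0
    obtain ⟨ε, hε, h⟩ := hF.exists_sign fun x hx h => by simpa using h0 x hx h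
    exact ⟨∅, by simp, by simp, ε, hε, by simpa using h⟩
  | insert a Z hZ ih =>
    intro I hF h0
    by_cases ha : a ∈ I ∧ F a = 0
    · obtain ⟨haI, ha0⟩ := ha
      obtain ⟨S, hSI, hS0, ε, hε, hS⟩ := ih (I ∩ Iio a)
        (fun x hx y hy hxy h => by
          obtain ⟨z, hz, h1, h2, h3⟩ := hF x hx.1 y hy.1 hxy h
          exact ⟨z, ⟨hz, h2.trans hy.2⟩, h1, h2, h3⟩)
        (fun x hx h => by
          rcases Finset.mem_insert.1 (h0 x hx.1 h) with rfl | h'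
          · exact (lt_irrefl x hx.2).elim
          · exact h')
      have hb : HasZeroBetween (I ∩ Ioi a) F := fun x hx y hy hxy h => by
        obtain ⟨z, hz, h1, h2, h3⟩ := hF x hx.1 y hy.1 hxy h
        exact ⟨z, ⟨hz, lt_trans hx.2 h1⟩, h1, h2, h3⟩
      obtain ⟨δ, hδ, hT⟩ := hb.exists_sign (fun x hx h => by
          rcases Finset.mem_insert.1 (h0 x hx.1 h) with rfl | h'
          · exact (lt_irrefl x hx.2).elim
          · exact absurd (hZ x h') (not_lt.2 (le_of_lt hx.2)))
      have haS : a ∉ S := fun h => lt_irrefl a (hSI h).2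
      have hpos : ∀ x, a < x → 0 ≤ ∏ s ∈ S, (x - s) := fun x hx =>
        Finset.prod_nonneg fun s hs => by
          have : s < a := (hSI hs).2
          linarith
      by_cases hεδ : δ = ε
      · refine ⟨S, fun s hs => (hSI hs).1, hS0, ε, hε, fun x hx => ?_⟩
        rcases lt_trichotomy x a with hxa | rfl | hxa
        · exact hS x ⟨hx, hxa⟩
        · simp [ha0]
        · have := mul_nonneg (hT x ⟨hx, hxa⟩) (hpos x hxa)
          rw [hεδ] at this
          linarith
      · have hδ' : δ = -ε := by
          rcases hε with rfl | rfl <;> rcases hδ with rfl | rfl <;> simp_all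
        refine ⟨insert a S, ?_, ?_, δ, hδ, fun x hx => ?_⟩
        · intro s hs
          rcases Finset.mem_insert.1 (Finset.mem_coe.1 hs) with rfl | hs
          · exact haI
          · exact (hSI hs).1
        · intro s hs
          rcases Finset.mem_insert.1 hs with rfl | hs
          · exact ha0
          · exact hS0 s hs
        · rw [Finset.prod_insert haS]
          rcases lt_trichotomy x a with hxa | rfl | hxa
          · have := mul_nonneg (hS x ⟨hx, hxa⟩) (sub_nonneg.2 hxa.le)
            rw [hδ']
            linarith
          · simp
          · have := mul_nonneg (mul_nonneg (hT x ⟨hx, hxa⟩) (hpos x hxa)) (sub_nonneg.2 hxa.le)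
            linarith
    · refine ih I hF fun x hx h => ?_
      rcases Finset.mem_insert.1 (h0 x hx h) with rfl | h'
      · exact absurd ⟨hx, h⟩ ha
      · exact h'

theorem HasZeroBetween.exists_isSignSet {I : Set ℝ} {F : ℝ → ℝ} (hF : HasZeroBetween I F)
    (hZ : {x ∈ I | F x = 0}.Finite) : ∃ S, IsSignSet I F S :=
  hF.exists_isSignSet_of_zeros F hZ.toFinset I fun x hx h => by simpa using ⟨hx, h⟩

theorem HasZeroBetween.of_continuousOn {I : Set ℝ} (hI : I.OrdConnected) {F : ℝ → ℝ}
    (hF : ∀ x ∈ I, ∀ y ∈ I, ContinuousOn F (Icc x y)) : HasZeroBetween I F := by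
  intro x hx y hy hxy h
  have hc := hF x hx y hy
  have h0 : (0 : ℝ) ∈ F '' Icc x y := by
    rcases mul_neg_iff.1 h with ⟨h1, h2⟩ | ⟨h1, h2⟩
    · exact intermediate_value_Icc' hxy.le hc ⟨h2.le, h1.le⟩
    · exact intermediate_value_Icc hxy.le hc ⟨h1.le, h2.le⟩
  obtain ⟨z, hz, hz0⟩ := h0
  have hzx : z ≠ x := by rintro rfl; simp [hz0] at h
  have hzy : z ≠ y := by rintro rfl; simp [hz0] at h
  exact ⟨z, hI.out hx hy hz, lt_of_le_of_ne hz.1 hzx.symm, lt_of_le_of_ne hz.2 hzy, hz0⟩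

theorem Polynomial.exists_isSignSet {I : Set ℝ} (hI : I.OrdConnected) {A : ℝ[X]} (hA : A ≠ 0) :
    ∃ S, IsSignSet I (fun x => A.eval x) S :=
  (HasZeroBetween.of_continuousOn hI fun _ _ _ _ => A.continuous.continuousOn).exists_isSignSet
    ((A.roots.toFinset.finite_toSet).subset fun x hx => by
      simpa [hA] using hx.2)

/-! ### Real simple zeros and interlacing of polynomials -/

open Polynomial Lagrange

theorem nodal_dvd_of_forall_isRoot {S : Finset ℝ} {A : ℝ[X]} (h : ∀ s ∈ S, A.eval s = 0) :
    nodal S id ∣ A := by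
  have hm := nodal_monic (s := S) (v := (id : ℝ → ℝ))
  rw [← modByMonic_eq_zero_iff_dvd hm]
  refine eq_zero_of_degree_lt_of_eval_finset_eq_zero S ?_ fun s hs => ?_
  · exact (degree_modByMonic_lt A hm).trans_eq degree_nodal
  · have := congrArg (eval s) (modByMonic_add_div A (nodal S id))
    rw [eval_add, eval_mul, h s hs, show eval s (nodal S id) = 0 from
      eval_nodal_at_node (v := id) hs] at this
    simpa using this

theorem IsSignSet.card_le_natDegree {I : Set ℝ} {A : ℝ[X]} {S : Finset ℝ}
    (hS : IsSignSet I (fun x => A.eval x) S) (hA : A ≠ 0) : S.card ≤ A.natDegree := by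
  have := natDegree_le_of_dvd (nodal_dvd_of_forall_isRoot hS.2.1) hA
  rwa [natDegree_nodal] at this

/-- A polynomial of degree at most `d + 1` with at least `d` sign changes on an open set has
only real and simple zeros. -/
theorem IsSignSet.hasRealSimpleZeros {I : Set ℝ} (hI : IsOpen I) {A : ℝ[X]} {S : Finset ℝ}
    (hS : IsSignSet I (fun x => A.eval x) S) (hA : A ≠ 0) {d : ℕ} (hd : d ≤ S.card)
    (hdeg : A.natDegree ≤ d + 1) : HasRealSimpleZeros A := by
  obtain ⟨hSI, hS0, ε, hε, hsgn⟩ := hS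
  obtain ⟨R, hR⟩ := nodal_dvd_of_forall_isRoot hS0
  have hR0 : R ≠ 0 := by rintro rfl; simp at hR; exact hA hR
  have hRdeg : R.natDegree ≤ 1 := by
    have := congrArg natDegree hR
    rw [natDegree_mul nodal_ne_zero hR0, natDegree_nodal] at this
    omega
  obtain ⟨a, b, hab⟩ := exists_eq_X_add_C_of_natDegree_le_one hRdeg
  have hRe : ∀ x, R.eval x = a * x + b := fun x => by rw [hab]; simp
  have hab0 : a ≠ 0 ∨ b ≠ 0 := by
    by_contra! h
    apply hR0; rw [hab, h.1, h.2]; simp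
  -- If the linear quotient `R` vanished at some `s ∈ S`, then `A` times the nodal polynomial of `S`
  -- would be a square times `a * (x - s)`, which takes both signs near `s`. As `I` is open, both
  -- sides of `s` are available.
  have hRS : ∀ s ∈ S, R.eval s ≠ 0 := by
    intro s hs h0
    have ha : a ≠ 0 := by
      rintro rfl
      rw [hRe] at h0
      simp at h0
      simp [h0] at hab0
    have hb : b = -a * s := by rw [hRe] at h0; linarith
    have hn : ∀ᶠ x in nhds s, x ∈ I ∩ ((S.erase s : Finset ℝ) : Set ℝ)ᶜ :=
      (hI.inter (S.erase s).finite_toSet.isClosed.isOpen_compl).mem_nhds ⟨hSI hs, by simp⟩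
    obtain ⟨δ, hδ, hball⟩ := Metric.eventually_nhds_iff.1 hn
    have key : ∀ x, x ≠ s → dist x s < δ → 0 ≤ ε * (a * (x - s)) := by
      intro x hxs hx
      obtain ⟨hxI, hxS⟩ := hball hx
      have hxS' : x ∉ S := fun h => hxS (by simp [hxs, h])
      have hpos : 0 < (∏ t ∈ S, (x - t)) * ∏ t ∈ S, (x - t) :=
        mul_self_pos.2 (Finset.prod_ne_zero_iff.2 fun t ht => sub_ne_zero.2 fun h =>
          hxS' (h ▸ ht))
      have h1 := hsgn x hxI
      have h2 : A.eval x = (∏ t ∈ S, (x - t)) * (a * (x - s)) := by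
        rw [hR, eval_mul, hRe, eval_nodal, hb]
        simp only [id]
        ring
      simp only [h2] at h1
      by_contra! hc
      nlinarith
    have k1 := key (s + δ / 2) (by linarith) (by
      rw [Real.dist_eq]; rw [abs_of_pos] <;> linarith)
    have k2 := key (s - δ / 2) (by linarith) (by
      rw [Real.dist_eq]; rw [abs_of_neg] <;> linarith)
    have h3 : ε * a * δ = 0 := by linarith
    have hε0 : ε ≠ 0 := by rcases hε with rfl | rfl <;> norm_num
    exact (mul_ne_zero (mul_ne_zero hε0 ha) hδ.ne') h3
  constructor
  · intro z hz
    rw [hR, map_mul, mul_eq_zero] at hz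
    rcases hz with hz | hz
    · rw [nodal, map_prod, Finset.prod_eq_zero_iff] at hz
      obtain ⟨s, -, hs⟩ := hz
      have : z = (s : ℂ) := by simpa [sub_eq_zero] using hs
      simp [this]
    · rw [hab] at hz
      have him := congrArg Complex.im hz
      have hre := congrArg Complex.re hz
      simp at him hre
      rcases him with h | h
      · subst h; simp at hre; simp [hre] at hab0
      · exact h
  · intro x hx
    refine le_antisymm ?_ ((rootMultiplicity_pos hA).2 hx)
    by_contra! hc
    obtain ⟨-, hd'⟩ := (one_lt_rootMultiplicity_iff_isRoot hA).1 hc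
    rw [IsRoot.def, hR, derivative_mul, eval_add, eval_mul, eval_mul] at hd'
    by_cases hxS : x ∈ S
    · have h0 : eval x (nodal S id) = 0 := eval_nodal_at_node (v := id) hxS
      rw [h0, zero_mul, add_zero] at hd'
      have h1 : eval x (derivative (nodal S id)) ≠ 0 := by
        have := eval_nodal_derivative_eval_node_eq (v := (id : ℝ → ℝ)) hxS
        simp only [id] at this
        rw [this, eval_nodal]
        refine Finset.prod_ne_zero_iff.2 fun t ht => sub_ne_zero.2 ?_
        exact (Finset.ne_of_mem_erase ht).symm
      exact mul_ne_zero h1 (hRS x hxS) hd'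
    · have h1 : eval x (nodal S id) ≠ 0 := by
        rw [eval_nodal]
        exact Finset.prod_ne_zero_iff.2 fun t ht => sub_ne_zero.2 fun h => hxS (by
          simp only [id] at h; exact h ▸ ht)
      have h2 : R.eval x = 0 := by
        rw [IsRoot.def, hR, eval_mul] at hx
        exact (mul_eq_zero.1 hx).resolve_left h1
      rw [h2, mul_zero, zero_add] at hd'
      have h3 := (mul_eq_zero.1 hd').resolve_left h1
      rw [hab] at h3
      simp at h3
      subst h3
      rw [hRe] at h2
      simp at h2
      simp [h2] at hab0

/-- If `q` had no zero between two zeros of `p`, then `p / q` would have a critical point there, a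
zero of the Wronskian. With the roles exchanged, two zeros of `q` would enclose a further zero of
`p`, which gives uniqueness. -/
theorem oneZeroBetween_of_wronskian_ne_zero {p q : ℝ[X]}
    (hW : ∀ x, p.eval x * (derivative q).eval x - (derivative p).eval x * q.eval x ≠ 0) :
    OneZeroBetween p q := by
  have rolle : ∀ (f g : ℝ[X]) (x y : ℝ),
      (∀ x, f.eval x * (derivative g).eval x - (derivative f).eval x * g.eval x ≠ 0) → x < y →
      f.eval x = 0 → f.eval y = 0 → ∃ t ∈ Icc x y, g.eval t = 0 := by
    intro f g x y hfg hxy hx hy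
    by_contra! hg
    obtain ⟨c, hc, hc0⟩ := exists_hasDerivAt_eq_zero
      (f := fun t => f.eval t / g.eval t)
      (f' := fun t => ((derivative f).eval t * g.eval t - f.eval t * (derivative g).eval t) /
        g.eval t ^ 2) hxy
      (f.continuous.continuousOn.div g.continuous.continuousOn hg) (by simp [hx, hy])
      (fun t ht => (f.hasDerivAt t).div (g.hasDerivAt t) (hg t ⟨ht.1.le, ht.2.le⟩))
    rw [div_eq_zero_iff] at hc0
    rcases hc0 with h | h
    · exact hfg c (by linarith)
    · exact hg c ⟨hc.1.le, hc.2.le⟩ (by simpa using h)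
  have hcommon : ∀ x, p.eval x = 0 → q.eval x ≠ 0 := fun x h1 h2 => hW x (by simp [h1, h2])
  intro x y hxy hx hy hcons
  obtain ⟨t, ht, ht0⟩ := rolle p q x y hW hxy hx hy
  have htx : t ≠ x := by rintro rfl; exact hcommon _ hx ht0
  have hty : t ≠ y := by rintro rfl; exact hcommon _ hy ht0
  refine ⟨t, ⟨⟨lt_of_le_of_ne ht.1 htx.symm, lt_of_le_of_ne ht.2 hty⟩, ht0⟩, ?_⟩
  have huniq : ∀ u v : ℝ, u ∈ Ioo x y → v ∈ Ioo x y → u < v → q.eval u = 0 → q.eval v = 0 →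
      False := by
    intro u v hu hv huv hu0 hv0
    obtain ⟨w, hw, hw0⟩ := rolle q p u v (fun x h => hW x (by linarith)) huv hu0 hv0
    exact hcons w ⟨hu.1.trans_le hw.1, hw.2.trans_lt hv.2⟩ hw0
  rintro u ⟨hu, hu0⟩
  have ht' : t ∈ Ioo x y := ⟨lt_of_le_of_ne ht.1 htx.symm, lt_of_le_of_ne ht.2 hty⟩
  rcases lt_trichotomy u t with h | h | h
  · exact (huniq u t hu ht' h hu0 ht0).elim
  · exact h
  · exact (huniq t u ht' hu h ht0 hu0).elim

theorem HasRealSimpleZeros.derivative_eval_ne_zero {p : ℝ[X]} (hp : HasRealSimpleZeros p) {x : ℝ}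
    (hx : p.eval x = 0) : (derivative p).eval x ≠ 0 := by
  intro h
  have h1 := hp.2 x hx
  have hp0 : p ≠ 0 := by rintro rfl; simp at h1
  have := (one_lt_rootMultiplicity_iff_isRoot hp0).2 ⟨hx, h⟩
  omega

/-- If all nontrivial linear combinations of two polynomials have real and simple zeros only,
then the two polynomials interlace. -/
theorem interlace_of_forall_combination {p q : ℝ[X]}
    (h : ∀ a b : ℝ, (a ≠ 0 ∨ b ≠ 0) → HasRealSimpleZeros (C a * p + C b * q)) :
    Interlace p q := by
  have hW : ∀ x, p.eval x * (derivative q).eval x - (derivative p).eval x * q.eval x ≠ 0 := by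
    intro x hx
    -- At a zero `x` of the Wronskian some nontrivial combination has a double zero: `q(x) p - p(x)
    -- q` in general, `q'(x) p - p'(x) q` at a common zero, and `p` itself if also `p'(x) = 0`.
    by_cases h0 : p.eval x = 0 ∧ q.eval x = 0
    · by_cases h1 : (derivative p).eval x = 0
      · refine (h 1 0 (by simp)).derivative_eval_ne_zero (x := x) ?_ ?_ <;> simp [h0.1, h1]
      · refine (h ((derivative q).eval x) (-(derivative p).eval x)
          (by simp [h1])).derivative_eval_ne_zero (x := x) ?_ ?_
        · simp [h0.1, h0.2]
        · simp; ring
    · refine (h (q.eval x) (-p.eval x) ?_).derivative_eval_ne_zero (x := x) ?_ ?_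
      · by_contra! hc
        exact h0 ⟨by simpa using hc.2, hc.1⟩
      · simp; ring
      · simp; linarith
  refine ⟨by simpa using h 1 0 (by simp), by simpa using h 0 1 (by simp), ?_,
    oneZeroBetween_of_wronskian_ne_zero hW,
    oneZeroBetween_of_wronskian_ne_zero fun x hx => hW x (by linarith)⟩
  rintro x ⟨h1, h2⟩
  rw [IsRoot.def] at h1 h2
  exact hW x (by simp [h1, h2])

theorem hasRealSimpleZeros_C {a : ℝ} (ha : a ≠ 0) : HasRealSimpleZeros (C a) :=
  ⟨fun z hz => by simp [ha] at hz, fun x hx => by simp [ha] at hx⟩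

theorem interlace_C {a b : ℝ} (ha : a ≠ 0) (hb : b ≠ 0) : Interlace (C a) (C b) :=
  ⟨hasRealSimpleZeros_C ha, hasRealSimpleZeros_C hb, fun x hx => by simp [ha] at hx,
    fun x y _ hx => by simp [ha] at hx, fun x y _ hx => by simp [hb] at hx⟩

/-! ### Divided differences and positivity of Stieltjes type -/

theorem sum_nodalWeight_mul_eval_eq_zero {Y : Finset ℝ} {p : ℝ[X]}
    (hp : p.degree < ((Y.card - 1 : ℕ) : WithBot ℕ)) :
    ∑ x ∈ Y, nodalWeight Y id x * p.eval x = 0 := by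
  have hp' : p.degree < (Y.card : WithBot ℕ) :=
    hp.trans_le (by exact_mod_cast Nat.sub_le _ _)
  have h := coeff_eq_sum (s := Y) (v := id) (injOn_id _) hp'
  rw [coeff_eq_zero_of_degree_lt hp] at h
  rw [h]
  refine Finset.sum_congr rfl fun x _ => ?_
  rw [nodalWeight, Finset.prod_inv_distrib, div_eq_inv_mul]
  rfl

theorem eval_eq_eval_nodal_mul_sum {Y : Finset ℝ} {p : ℝ[X]} (hp : p.degree < (Y.card : WithBot ℕ))
    {t : ℝ} (ht : t ∉ Y) :
    p.eval t = (nodal Y id).eval t *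
      ∑ x ∈ Y, nodalWeight Y id x * p.eval x * (t - x)⁻¹ := by
  conv_lhs => rw [eq_interpolate (s := Y) (v := id) (injOn_id _) hp]
  rw [eval_interpolate_not_at_node _ fun x hx h => ht (by
    simp only [id] at h; exact h ▸ hx)]
  congr 1
  exact Finset.sum_congr rfl fun x _ => by simp only [id]; ring

theorem eval_nodal_ne_zero {Y : Finset ℝ} {t : ℝ} (ht : t ∉ Y) : (nodal Y id).eval t ≠ 0 :=
  eval_nodal_not_at_node fun x hx h => ht (by simp only [id] at h; exact h ▸ hx)

/-- The divided difference of `q * m` at the nodes `Y`. -/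
noncomputable def dividedDifference (Y : Finset ℝ) (m : ℝ → ℝ) : ℝ[X] →ₗ[ℝ] ℝ where
  toFun q := ∑ x ∈ Y, nodalWeight Y id x * q.eval x * m x
  map_add' p q := by
    rw [← Finset.sum_add_distrib]
    exact Finset.sum_congr rfl fun x _ => by rw [eval_add]; ring
  map_smul' c q := by
    rw [RingHom.id_apply, smul_eq_mul, Finset.mul_sum]
    exact Finset.sum_congr rfl fun x _ => by rw [eval_smul, smul_eq_mul]; ring

theorem dividedDifference_apply (Y : Finset ℝ) (m : ℝ → ℝ) (q : ℝ[X]) :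
    dividedDifference Y m q = ∑ x ∈ Y, nodalWeight Y id x * q.eval x * m x := rfl

/-- The divided differences of `q * m` at `Y` are of one strict sign for the nonzero polynomials
`q` of small degree that are non-negative on `I`. -/
def StieltjesPos (Y : Finset ℝ) (I : Set ℝ) (m : ℝ → ℝ) : Prop :=
  ∃ ε : ℝ, ∀ q : ℝ[X], q ≠ 0 → q.degree < (Y.card : WithBot ℕ) → (∀ x ∈ I, 0 ≤ q.eval x) →
    0 < ε * dividedDifference Y m q

theorem degree_mul_nodal_lt {A : ℝ[X]} {S : Finset ℝ} {r n : ℕ}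
    (hA : A.degree < (r : WithBot ℕ)) (h : r + S.card ≤ n) :
    (A * nodal S id).degree < (n : WithBot ℕ) := by
  by_cases h0 : A = 0
  · rw [h0, zero_mul, degree_zero]; exact WithBot.bot_lt_coe n
  · rw [degree_mul, degree_nodal, degree_eq_natDegree h0]
    rw [degree_eq_natDegree h0] at hA
    have hA' : A.natDegree < r := by exact_mod_cast hA
    have : A.natDegree + S.card < n := by omega
    exact_mod_cast this

/-- With fewer than `d` sign changes, let `ω` be their nodal polynomial. The divided difference of
`B ω m` equals that of `-A ω`, which vanishes because `A ω` has degree below `|Y| - 1`. But `±B ω`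
is nonnegative on `I` and of degree below `|Y|`, so positivity is contradicted. -/
theorem StieltjesPos.exists_isSignSet {Y : Finset ℝ} {I : Set ℝ} {m : ℝ → ℝ}
    (h : StieltjesPos Y I m) (hI : I.OrdConnected) {A B : ℝ[X]} (hB : B ≠ 0)
    (hY : ∀ x ∈ Y, A.eval x + B.eval x * m x = 0) {r d : ℕ}
    (hAr : A.degree < (r : WithBot ℕ)) (hBr : B.degree < ((r + 1 : ℕ) : WithBot ℕ))
    (hrd : r + d ≤ Y.card) :
    ∃ S, IsSignSet I (fun x => B.eval x) S ∧ d ≤ S.card := by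
  obtain ⟨S, hS⟩ := Polynomial.exists_isSignSet hI hB
  refine ⟨S, hS, ?_⟩
  by_contra! hSd
  obtain ⟨-, -, δ, hδ, hsgn⟩ := hS
  obtain ⟨ε, hε⟩ := h
  have hδ0 : δ ≠ 0 := by rcases hδ with rfl | rfl <;> norm_num
  have h1 := hε (δ • (B * nodal S id)) (smul_ne_zero hδ0 (mul_ne_zero hB nodal_ne_zero))
    ((degree_smul_le _ _).trans_lt (degree_mul_nodal_lt hBr (by omega)))
    (fun x hx => by
      rw [eval_smul, eval_mul, eval_nodal]; exact hsgn x hx)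
  have h2 : dividedDifference Y m (B * nodal S id) = 0 := by
    have h3 := sum_nodalWeight_mul_eval_eq_zero (Y := Y) (p := A * nodal S id)
      (degree_mul_nodal_lt hAr (by omega))
    rw [dividedDifference_apply, ← neg_eq_zero, ← Finset.sum_neg_distrib, ← h3]
    refine Finset.sum_congr rfl fun x hx => ?_
    have := hY x hx
    rw [eval_mul, eval_mul, show A.eval x = - (B.eval x * m x) by linarith]
    ring
  rw [map_smul, h2] at h1
  simp at h1

/-! ### Gauss quadrature and discrete representation on finite sets -/

theorem degree_lt_of_natDegree_lt {p : ℝ[X]} {n : ℕ} (h : p.natDegree < n) :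
    p.degree < (n : WithBot ℕ) :=
  degree_le_natDegree.trans_lt (by exact_mod_cast h)

/-- A Gauss quadrature formula for a positive functional on polynomials. -/
theorem exists_gauss_quadrature {I : Set ℝ} (hI : I.OrdConnected) (Λ : ℝ[X] →ₗ[ℝ] ℝ) (M : ℕ)
    (hΛ : ∀ q : ℝ[X], q ≠ 0 → q.degree < ((2 * M : ℕ) : WithBot ℕ) → (∀ x ∈ I, 0 ≤ q.eval x) →
      0 < Λ q) :
    ∃ (T : Finset ℝ) (w : ℝ → ℝ), (T : Set ℝ) ⊆ I ∧ T.card = M ∧ (∀ t ∈ T, 0 < w t) ∧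
      ∀ p : ℝ[X], p.degree < ((2 * M : ℕ) : WithBot ℕ) → Λ p = ∑ t ∈ T, w t * p.eval t := by
  -- `D` is the orthogonal polynomial of `Λ`; it exists because there are `M` linear conditions on
  -- `M + 1` coefficients. The nodes will be its zeros.
  obtain ⟨D, hD0, hDdeg, hDorth⟩ : ∃ D : ℝ[X], D ≠ 0 ∧ D.degree < ((M + 1 : ℕ) : WithBot ℕ) ∧
      ∀ k < M, Λ (D * X ^ k) = 0 := by
    let φ : degreeLT ℝ (M + 1) →ₗ[ℝ] (Fin M → ℝ) :=
      LinearMap.pi fun k => Λ ∘ₗ (LinearMap.mulRight ℝ (X ^ (k : ℕ))) ∘ₗ (degreeLT ℝ (M + 1)).subtype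
    have hfin : Module.finrank ℝ (Fin M → ℝ) < Module.finrank ℝ (degreeLT ℝ (M + 1)) := by
      rw [(degreeLTEquiv ℝ (M + 1)).finrank_eq]; simp
    have : FiniteDimensional ℝ (degreeLT ℝ (M + 1)) :=
      FiniteDimensional.of_finrank_pos (by omega)
    obtain ⟨D, hD, hD0⟩ := Submodule.exists_mem_ne_zero_of_ne_bot
      (LinearMap.ker_ne_bot_of_finrank_lt (f := φ) hfin)
    refine ⟨D, fun h => hD0 (Subtype.ext h), mem_degreeLT.1 D.2, fun k hk => ?_⟩
    exact congrFun (LinearMap.mem_ker.1 hD) ⟨k, hk⟩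
  have horth : ∀ q : ℝ[X], q.degree < (M : WithBot ℕ) → Λ (D * q) = 0 := by
    intro q hq
    by_cases hq0 : q = 0
    · simp [hq0]
    rw [as_sum_range' q M (by
      rw [degree_eq_natDegree hq0] at hq; exact_mod_cast hq), Finset.mul_sum, map_sum]
    refine Finset.sum_eq_zero fun k hk => ?_
    rw [← C_mul_X_pow_eq_monomial, ← smul_eq_C_mul, mul_smul_comm, map_smul,
      hDorth k (Finset.mem_range.1 hk), smul_zero]
  obtain ⟨T, hT⟩ := Polynomial.exists_isSignSet hI hD0
  have hDnat : D.natDegree ≤ M := by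
    rw [degree_eq_natDegree hD0] at hDdeg
    exact Nat.lt_succ_iff.1 (by exact_mod_cast hDdeg)
  have hTM : T.card = M := by
    refine le_antisymm ((hT.card_le_natDegree hD0).trans hDnat) ?_
    by_contra! hlt
    obtain ⟨-, -, δ, hδ, hsgn⟩ := hT
    have hδ0 : δ ≠ 0 := by rcases hδ with rfl | rfl <;> norm_num
    have h1 := hΛ (δ • (D * nodal T id)) (smul_ne_zero hδ0 (mul_ne_zero hD0 nodal_ne_zero))
      ((degree_smul_le _ _).trans_lt (degree_mul_nodal_lt hDdeg (by omega)))
      (fun x hx => by rw [eval_smul, eval_mul, eval_nodal]; exact hsgn x hx)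
    rw [map_smul, horth _ (by rw [degree_nodal]; exact_mod_cast hlt)] at h1
    simp at h1
  obtain ⟨R, hR⟩ := nodal_dvd_of_forall_isRoot hT.2.1
  have hR0 : R ≠ 0 := by rintro rfl; simp at hR; exact hD0 hR
  have hRdeg : R.natDegree = 0 := by
    have := congrArg natDegree hR
    rw [natDegree_mul nodal_ne_zero hR0, natDegree_nodal] at this
    omega
  obtain ⟨c, rfl⟩ := natDegree_eq_zero.1 hRdeg
  have hc : c ≠ 0 := by rintro rfl; simp at hR0
  have horth' : ∀ q : ℝ[X], q.degree < (M : WithBot ℕ) → Λ (nodal T id * q) = 0 := by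
    intro q hq
    have := horth q hq
    rw [hR, mul_comm (nodal T id), mul_assoc, ← smul_eq_C_mul, map_smul, smul_eq_zero] at this
    exact this.resolve_left hc
  have hm := nodal_monic (s := T) (v := (id : ℝ → ℝ))
  -- Divide `p` by the nodal polynomial: the quotient has degree below `M` and contributes nothing
  -- by orthogonality; the remainder is interpolated exactly.
  have hquad : ∀ p : ℝ[X], p.degree < ((2 * M : ℕ) : WithBot ℕ) →
      Λ p = ∑ t ∈ T, Λ (Lagrange.basis T id t) * p.eval t := by
    intro p hp
    have hr : (p %ₘ nodal T id).degree < (T.card : WithBot ℕ) :=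
      (degree_modByMonic_lt p hm).trans_eq degree_nodal
    have hq : (p /ₘ nodal T id).degree < (M : WithBot ℕ) := by
      by_cases hz : p /ₘ nodal T id = 0
      · rw [hz, degree_zero]; exact WithBot.bot_lt_coe M
      · have hp0 : p ≠ 0 := by rintro rfl; simp at hz
        have hpn : p.natDegree < 2 * M := by
          rw [degree_eq_natDegree hp0] at hp; exact_mod_cast hp
        have hle : ¬ p.degree < (nodal T (id : ℝ → ℝ)).degree := fun h =>
          hz ((divByMonic_eq_zero_iff hm).2 h)
        rw [degree_nodal, degree_eq_natDegree hp0] at hle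
        have hle' : T.card ≤ p.natDegree := by
          by_contra! h
          exact hle (by exact_mod_cast h)
        apply degree_lt_of_natDegree_lt
        rw [natDegree_divByMonic p hm, natDegree_nodal]
        omega
    have hsplit := modByMonic_add_div p (nodal T (id : ℝ → ℝ))
    have heval : ∀ t ∈ T, (p %ₘ nodal T id).eval t = p.eval t := by
      intro t ht
      have := congrArg (eval t) hsplit
      rw [eval_add, eval_mul, show eval t (nodal T id) = 0 from
        eval_nodal_at_node (v := id) ht] at this
      simpa using this
    rw [← hsplit, map_add, horth' _ hq, add_zero, hsplit,
      eq_interpolate (s := T) (v := id) (injOn_id _) hr, interpolate_apply, map_sum]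
    refine Finset.sum_congr rfl fun t ht => ?_
    rw [← smul_eq_C_mul, map_smul, smul_eq_mul, mul_comm]
    congr 1
    exact heval t ht
  refine ⟨T, fun t => Λ (Lagrange.basis T id t), hT.1, hTM, fun t ht => ?_, hquad⟩
  have hb0 : Lagrange.basis T (id : ℝ → ℝ) t ≠ 0 := basis_ne_zero (injOn_id _) ht
  have hdeg : (Lagrange.basis T (id : ℝ → ℝ) t * Lagrange.basis T id t).degree <
      ((2 * M : ℕ) : WithBot ℕ) := by
    apply degree_lt_of_natDegree_lt
    rw [natDegree_mul hb0 hb0, natDegree_basis (injOn_id _) ht]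
    have := Finset.card_pos.2 ⟨t, ht⟩
    omega
  -- The quadrature formula applied to the square of a Lagrange basis polynomial, of degree `2 * M -
  -- 2`, returns the weight itself.
  have hpos := hΛ _ (mul_ne_zero hb0 hb0) hdeg
    (fun x _ => by rw [eval_mul]; exact mul_self_nonneg _)
  rw [hquad _ hdeg, Finset.sum_eq_single t] at hpos
  · rw [eval_mul, show eval t (Lagrange.basis T id t) = 1 from
      eval_basis_self (v := id) (injOn_id _) ht] at hpos
    simpa using hpos
  · intro s hs hst
    rw [eval_mul, show eval s (Lagrange.basis T id t) = 0 from
      eval_basis_of_ne (v := id) hst.symm hs]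
    simp
  · exact fun h => absurd ht h

theorem exists_sign_nodal {I : Set ℝ} (hI : I.OrdConnected) {Y : Finset ℝ}
    (hY : ∀ x ∈ Y, x ∉ I) : ∃ δ : ℝ, (δ = 1 ∨ δ = -1) ∧ ∀ t ∈ I, 0 < δ * (nodal Y id).eval t := by
  have h0 : ∀ t ∈ I, (nodal Y id).eval t ≠ 0 := fun t ht =>
    eval_nodal_ne_zero fun h => hY t h ht
  obtain ⟨δ, hδ, h⟩ := (HasZeroBetween.of_continuousOn hI (F := fun x => (nodal Y id).eval x)
    fun _ _ _ _ => (nodal Y id).continuous.continuousOn).exists_sign h0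
  have hδ0 : δ ≠ 0 := by rcases hδ with rfl | rfl <;> norm_num
  exact ⟨δ, hδ, fun t ht => lt_of_le_of_ne (h t ht) (mul_ne_zero hδ0 (h0 t ht)).symm⟩

/-- Gauss quadrature for the divided difference functional, applied to the nodal polynomial of `Y`
without `x`, isolates the value `m x`. That polynomial has degree `2 * M - 1`, just within the range
of exactness. The nodal polynomial of `Y` has one sign on `I`, so it can be absorbed into the
weights. -/
theorem StieltjesPos.exists_discrete {Y : Finset ℝ} {I : Set ℝ} {m : ℝ → ℝ}
    (h : StieltjesPos Y I m) (hI : I.OrdConnected) (hYI : ∀ x ∈ Y, x ∉ I) {M : ℕ} (hM : 0 < M)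
    (hY : Y.card = 2 * M) :
    ∃ (T : Finset ℝ) (w : ℝ → ℝ) (κ : ℝ), (T : Set ℝ) ⊆ I ∧ T.card = M ∧ (∀ t ∈ T, 0 < w t) ∧
      κ ≠ 0 ∧ ∀ x ∈ Y, m x = κ * ∑ t ∈ T, w t * (t - x)⁻¹ := by
  obtain ⟨ε, hε⟩ := h
  have hε0 : ε ≠ 0 := by
    rintro rfl
    have := hε 1 one_ne_zero (by rw [degree_one, hY]; exact_mod_cast (by omega : 0 < 2 * M))
      (by simp)
    simp at this
  obtain ⟨T, w, hTI, hTM, hw, hquad⟩ := exists_gauss_quadrature hI (ε • dividedDifference Y m) M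
    (fun q hq hdeg hpos => by
      rw [LinearMap.smul_apply, smul_eq_mul]; exact hε q hq (by rwa [hY]) hpos)
  obtain ⟨δ, hδ, hδpos⟩ := exists_sign_nodal hI hYI
  have hδ2 : δ * δ = 1 := by rcases hδ with rfl | rfl <;> norm_num
  refine ⟨T, fun t => w t * (δ * (nodal Y id).eval t), δ / ε, hTI, hTM,
    fun t ht => mul_pos (hw t ht) (hδpos t (hTI ht)), div_ne_zero ?_ hε0, fun x hx => ?_⟩
  · rintro rfl; simp at hδ2
  have h1 := hquad (nodal (Y.erase x) id) (by
    rw [degree_nodal, Finset.card_erase_of_mem hx, hY]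
    exact_mod_cast (by omega : 2 * M - 1 < 2 * M))
  rw [LinearMap.smul_apply, smul_eq_mul, dividedDifference_apply, Finset.sum_eq_single x] at h1
  · have h2 : nodalWeight Y id x * eval x (nodal (Y.erase x) id) = 1 := by
      rw [nodalWeight_eq_eval_nodal_erase_inv]
      exact inv_mul_cancel₀ (eval_nodal_ne_zero (Finset.notMem_erase x Y))
    rw [h2, one_mul] at h1
    have h3 : ∀ t ∈ T, w t * (δ * (nodal Y id).eval t) * (t - x)⁻¹ =
        δ * (w t * eval t (nodal (Y.erase x) id)) := by
      intro t ht
      have htx : t - x ≠ 0 := sub_ne_zero.2 fun h => hYI x hx (h ▸ hTI ht)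
      rw [nodal_eq_mul_nodal_erase (v := id) hx, eval_mul, eval_sub, eval_X, eval_C, id]
      field_simp
    rw [Finset.sum_congr rfl h3, ← Finset.mul_sum, ← h1]
    field_simp
    linear_combination (-m x) * hδ2
  · intro y hy hyx
    rw [show eval y (nodal (Y.erase x) id) = 0 from
      eval_nodal_at_node (v := id) (Finset.mem_erase.2 ⟨hyx, hy⟩)]
    simp
  · exact fun h => absurd hx h

/-! ### Reciprocals of discrete Stieltjes transforms -/

theorem natDegree_sum_C_mul_nodal_erase_le (T : Finset ℝ) (w : ℝ → ℝ) :
    (∑ t ∈ T, C (w t) * nodal (T.erase t) (id : ℝ → ℝ)).natDegree ≤ T.card - 1 := by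
  refine natDegree_sum_le_of_forall_le _ _ fun t ht => ?_
  refine (natDegree_C_mul_le _ _).trans ?_
  rw [natDegree_nodal, Finset.card_erase_of_mem ht]

theorem eval_sum_C_mul_nodal_erase_of_mem {T : Finset ℝ} (w : ℝ → ℝ) {t : ℝ} (ht : t ∈ T) :
    (∑ t ∈ T, C (w t) * nodal (T.erase t) (id : ℝ → ℝ)).eval t * nodalWeight T id t = w t := by
  rw [eval_finsetSum, Finset.sum_eq_single t]
  · rw [nodalWeight_eq_eval_nodal_erase_inv, eval_mul, eval_C, mul_assoc]
    rw [id, mul_inv_cancel₀ (eval_nodal_ne_zero (Finset.notMem_erase t T)), mul_one]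
  · intro s hs hst
    rw [eval_mul, show eval t (nodal (T.erase s) id) = 0 from
      eval_nodal_at_node (v := id) (Finset.mem_erase.2 ⟨hst.symm, ht⟩), mul_zero]
  · exact fun h => absurd ht h

theorem eval_sum_C_mul_nodal_erase_of_notMem {T : Finset ℝ} (w : ℝ → ℝ) {x : ℝ} (hx : x ∉ T) :
    (∑ t ∈ T, C (w t) * nodal (T.erase t) (id : ℝ → ℝ)).eval x =
      -(nodal T id).eval x * ∑ t ∈ T, w t * (t - x)⁻¹ := by
  rw [eval_finsetSum, Finset.mul_sum]
  refine Finset.sum_congr rfl fun t ht => ?_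
  have : t - x ≠ 0 := sub_ne_zero.2 fun h => hx (h ▸ ht)
  rw [nodal_eq_mul_nodal_erase (v := id) ht]
  simp only [eval_mul, eval_C, eval_sub, eval_X, id]
  field_simp
  ring

/-- At a zero `s` of the transform, this writes the quotient of its numerator by `X - C s` as a
numerator of the same kind. Evaluating it at `s` gives the derivative of the numerator there, hence
the residues of the reciprocal. -/
theorem X_sub_C_mul_sum_C_mul_nodal_erase {T : Finset ℝ} (w : ℝ → ℝ) {s : ℝ} (hs : s ∉ T)
    (h0 : ∑ t ∈ T, w t * (t - s)⁻¹ = 0) :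
    (X - C s) * ∑ t ∈ T, C (w t * (t - s)⁻¹) * nodal (T.erase t) (id : ℝ → ℝ) =
      ∑ t ∈ T, C (w t) * nodal (T.erase t) (id : ℝ → ℝ) := by
  have h1 : ∀ t ∈ T, (X - C s) * (C (w t * (t - s)⁻¹) * nodal (T.erase t) (id : ℝ → ℝ)) =
      C (w t * (t - s)⁻¹) * nodal T id + C (w t) * nodal (T.erase t) (id : ℝ → ℝ) := by
    intro t ht
    have hts : t - s ≠ 0 := sub_ne_zero.2 fun h => hs (h ▸ ht)
    have h2 : C (w t) = C (w t * (t - s)⁻¹) * (C t - C s) := by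
      rw [← C_sub, ← C_mul, inv_mul_cancel_right₀ hts]
    rw [nodal_eq_mul_nodal_erase (v := id) ht, h2, id]
    ring
  rw [Finset.mul_sum, Finset.sum_congr rfl h1, Finset.sum_add_distrib, ← Finset.sum_mul,
    ← map_sum, h0]
  simp

/-- The reciprocal of the Stieltjes transform of a discrete measure is, up to a polynomial of
degree one, the Stieltjes transform of a discrete measure of constant sign. -/
theorem exists_inv_discrete {I : Set ℝ} (hI : I.OrdConnected) {T : Finset ℝ} {w : ℝ → ℝ} {K : ℕ}
    (hTI : (T : Set ℝ) ⊆ I) (hT : T.card = K + 1) (hw : ∀ t ∈ T, 0 < w t) :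
    ∃ (S : Finset ℝ) (v : ℝ → ℝ) (ℓ : ℝ[X]), (S : Set ℝ) ⊆ I ∧ S.card = K ∧ (∀ s ∈ S, 0 < v s) ∧
      ℓ.natDegree ≤ 1 ∧ ∀ x ∉ I, ∑ t ∈ T, w t * (t - x)⁻¹ ≠ 0 ∧
        (∑ t ∈ T, w t * (t - x)⁻¹)⁻¹ = ℓ.eval x + ∑ s ∈ S, v s * (x - s)⁻¹ := by
  set P := ∑ t ∈ T, C (w t) * nodal (T.erase t) (id : ℝ → ℝ) with hP
  have hPdeg : P.natDegree ≤ K := by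
    have := natDegree_sum_C_mul_nodal_erase_le T w
    rwa [hT] at this
  have hPT : ∀ t ∈ T, P.eval t * nodalWeight T id t = w t := fun t ht =>
    eval_sum_C_mul_nodal_erase_of_mem w ht
  have hPT0 : ∀ t ∈ T, P.eval t ≠ 0 := fun t ht h => by
    have := hPT t ht
    rw [h, zero_mul] at this
    exact (hw t ht).ne this
  have hTne : T.Nonempty := Finset.card_pos.1 (by omega)
  have hP0 : P ≠ 0 := by
    obtain ⟨t, ht⟩ := hTne
    exact fun h => hPT0 t ht (by rw [h, eval_zero])
  obtain ⟨S, hS⟩ := Polynomial.exists_isSignSet hI hP0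
  -- On `T` the numerator `P` has the sign of the nodal weights. With fewer than `K` sign changes,
  -- the vanishing divided difference of their nodal polynomial would be a sum of terms of one sign,
  -- forcing that polynomial to vanish on all of `T`.
  have hSK : S.card = K := by
    refine le_antisymm ((hS.card_le_natDegree hP0).trans hPdeg) ?_
    by_contra! hlt
    obtain ⟨-, -, δ, hδ, hsgn⟩ := hS
    have hδ0 : δ ≠ 0 := by rcases hδ with rfl | rfl <;> norm_num
    have h1 := sum_nodalWeight_mul_eval_eq_zero (Y := T) (p := nodal S id) (by
      rw [degree_nodal, hT]; exact_mod_cast hlt)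
    have h2 : ∑ t ∈ T, δ * (nodalWeight T id t * (nodal S id).eval t) = 0 := by
      rw [← Finset.mul_sum, h1, mul_zero]
    have h3 : ∀ t ∈ T, δ * (nodalWeight T id t * (nodal S id).eval t) =
        nodalWeight T id t ^ 2 / w t * (δ * (P.eval t * ∏ s ∈ S, (t - s))) := by
      intro t ht
      have := (hw t ht).ne'
      rw [eval_nodal]
      field_simp
      rw [← hPT t ht]
      simp only [id]
      ring
    rw [Finset.sum_congr rfl h3, Finset.sum_eq_zero_iff_of_nonneg fun t ht =>
      mul_nonneg (div_nonneg (sq_nonneg _) (hw t ht).le) (hsgn t (hTI ht))] at h2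
    have h4 : nodal S (id : ℝ → ℝ) = 0 := by
      refine eq_zero_of_degree_lt_of_eval_finset_eq_zero T ?_ fun t ht => ?_
      · rw [degree_nodal, hT]; exact_mod_cast (by omega : S.card < K + 1)
      · have h5 := h2 t ht
        rw [eval_nodal]
        simp only [id]
        rcases mul_eq_zero.1 h5 with h | h
        · rw [div_eq_zero_iff] at h
          rcases h with h | h
          · exact absurd (pow_eq_zero_iff two_ne_zero |>.1 h) (nodalWeight_ne_zero (injOn_id _) ht)
          · exact absurd h (hw t ht).ne'
        · exact ((mul_eq_zero.1 ((mul_eq_zero.1 h).resolve_left hδ0))).resolve_left (hPT0 t ht)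
    exact nodal_ne_zero h4
  obtain ⟨R, hR⟩ := nodal_dvd_of_forall_isRoot hS.2.1
  have hR0 : R ≠ 0 := by rintro rfl; simp at hR; exact hP0 hR
  have hRdeg : R.natDegree = 0 := by
    have := congrArg natDegree hR
    rw [natDegree_mul nodal_ne_zero hR0, natDegree_nodal] at this
    omega
  obtain ⟨c, rfl⟩ := natDegree_eq_zero.1 hRdeg
  have hc : c ≠ 0 := by rintro rfl; simp at hR0
  have hST : ∀ s ∈ S, s ∉ T := fun s hs ht => hPT0 s ht (hS.2.1 s hs)
  -- This is the residue at `s` of the reciprocal transform, that is, the reciprocal of the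
  -- derivative `∑ w t / (t - s)²`, which is positive.
  have hcS : ∀ s ∈ S, 0 < -(nodalWeight S id s * (nodal T id).eval s) / c := by
    intro s hs
    have hsT := hST s hs
    have hD0 := eval_nodal_ne_zero hsT
    have h0 : ∑ t ∈ T, w t * (t - s)⁻¹ = 0 := by
      have := eval_sum_C_mul_nodal_erase_of_notMem w hsT
      rw [← hP, show P.eval s = 0 from hS.2.1 s hs] at this
      exact (mul_eq_zero.1 this.symm).resolve_left (neg_ne_zero.2 hD0)
    have h1 := X_sub_C_mul_sum_C_mul_nodal_erase w hsT h0
    rw [← hP, hR, nodal_eq_mul_nodal_erase (v := id) hs, id, mul_assoc] at h1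
    have h2 := congrArg (eval s) (mul_left_cancel₀ (X_sub_C_ne_zero s) h1)
    rw [eval_sum_C_mul_nodal_erase_of_notMem _ hsT, eval_mul, eval_C] at h2
    have h3 : nodalWeight S id s * eval s (nodal (S.erase s) id) = 1 := by
      rw [nodalWeight_eq_eval_nodal_erase_inv]
      exact inv_mul_cancel₀ (eval_nodal_ne_zero (Finset.notMem_erase s S))
    have h4 : 0 < ∑ t ∈ T, w t * (t - s)⁻¹ * (t - s)⁻¹ := by
      refine Finset.sum_pos (fun t ht => ?_) hTne
      have : (t - s)⁻¹ ≠ 0 := inv_ne_zero (sub_ne_zero.2 fun h => hsT (h ▸ ht))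
      rw [mul_assoc]
      exact mul_pos (hw t ht) (mul_self_pos.2 this)
    have h5 : c = -(nodalWeight S id s * (nodal T id).eval s) *
        ∑ t ∈ T, w t * (t - s)⁻¹ * (t - s)⁻¹ := by
      linear_combination nodalWeight S id s * (-h2) - c * h3
    have h6 : -(nodalWeight S id s * (nodal T id).eval s) ≠ 0 := by
      intro h; rw [h, zero_mul] at h5; exact hc h5
    rw [h5]
    rw [div_mul_eq_div_div, div_self h6]
    positivity
  have hm := nodal_monic (s := S) (v := (id : ℝ → ℝ))
  have hr : (nodal T id %ₘ nodal S id).degree < (S.card : WithBot ℕ) :=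
    (degree_modByMonic_lt _ hm).trans_eq degree_nodal
  have hsplit := modByMonic_add_div (nodal T id) (nodal S (id : ℝ → ℝ))
  have heval : ∀ s ∈ S, (nodal T id %ₘ nodal S id).eval s = (nodal T id).eval s := by
    intro s hs
    have := congrArg (eval s) hsplit
    rw [eval_add, eval_mul, show eval s (nodal S id) = 0 from
      eval_nodal_at_node (v := id) hs] at this
    simpa using this
  refine ⟨S, fun s => -(nodalWeight S id s * (nodal T id).eval s) / c,
    C (-1 / c) * (nodal T id /ₘ nodal S id), hS.1, hSK, hcS, ?_, fun x hx => ?_⟩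
  · refine (natDegree_C_mul_le _ _).trans ?_
    rw [natDegree_divByMonic _ hm, natDegree_nodal, natDegree_nodal]
    omega
  · have hxT : x ∉ T := fun h => hx (hTI h)
    have hxS : x ∉ S := fun h => hx (hS.1 h)
    have hDx := eval_nodal_ne_zero hxT
    have hSx := eval_nodal_ne_zero hxS
    have h1 := eval_sum_C_mul_nodal_erase_of_notMem w hxT
    rw [← hP, hR, eval_mul, eval_C] at h1
    set f := ∑ t ∈ T, w t * (t - x)⁻¹
    have hf : f ≠ 0 := by
      intro h
      rw [h, mul_zero] at h1
      exact mul_ne_zero hSx hc h1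
    refine ⟨hf, ?_⟩
    have h2 := congrArg (eval x) hsplit
    rw [eval_add, eval_mul, eval_eq_eval_nodal_mul_sum hr hxS] at h2
    have h3 : ∑ s ∈ S, -(nodalWeight S id s * (nodal T id).eval s) / c * (x - s)⁻¹ =
        -1 / c * ∑ s ∈ S, nodalWeight S id s * (nodal T id %ₘ nodal S id).eval s * (x - s)⁻¹ := by
      rw [Finset.mul_sum]
      refine Finset.sum_congr rfl fun s hs => ?_
      rw [heval s hs]; ring
    rw [h3, eval_mul, eval_C]
    set u := ∑ s ∈ S, nodalWeight S id s * (nodal T id %ₘ nodal S id).eval s * (x - s)⁻¹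
    set l := eval x (nodal T id /ₘ nodal S id)
    have h4 : eval x (nodal S id) * (c + (u + l) * f) = 0 := by
      linear_combination h1 + f * h2
    have h5 := (mul_eq_zero.1 h4).resolve_left hSx
    refine inv_eq_of_mul_eq_one_right ?_
    field_simp
    linarith

/-- By Lagrange interpolation the divided difference is `-c` times the sum of `v s * q(s) / ω_Y(s)`,
with `ω_Y` of one sign on `I`. It is nonzero because `q`, of degree below `|Y| ≤ |S|`, cannot vanish
at every atom. -/
theorem stieltjesPos_discrete {Y S : Finset ℝ} {I : Set ℝ} (hI : I.OrdConnected)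
    (hYI : ∀ x ∈ Y, x ∉ I) (hSI : (S : Set ℝ) ⊆ I) (hYS : Y.card ≤ S.card) {v : ℝ → ℝ}
    (hv : ∀ s ∈ S, 0 < v s) {c : ℝ} (hc : c ≠ 0) :
    StieltjesPos Y I (fun x => c * ∑ s ∈ S, v s * (x - s)⁻¹) := by
  obtain ⟨δ, hδ, hδpos⟩ := exists_sign_nodal hI hYI
  have hδ2 : δ * δ = 1 := by rcases hδ with rfl | rfl <;> norm_num
  refine ⟨-δ / c, fun q hq hdeg hpos => ?_⟩
  have h1 : dividedDifference Y (fun x => c * ∑ s ∈ S, v s * (x - s)⁻¹) q =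
      -c * ∑ s ∈ S, v s * (q.eval s / (nodal Y id).eval s) := by
    have h2 : ∀ s ∈ S, v s * (q.eval s / (nodal Y id).eval s) =
        ∑ x ∈ Y, v s * (nodalWeight Y id x * q.eval x * (s - x)⁻¹) := by
      intro s hs
      have hsY : s ∉ Y := fun h => hYI s h (hSI hs)
      rw [eval_eq_eval_nodal_mul_sum hdeg hsY, mul_div_cancel_left₀ _ (eval_nodal_ne_zero hsY),
        Finset.mul_sum]
    rw [Finset.sum_congr rfl h2, Finset.sum_comm, dividedDifference_apply, Finset.mul_sum]
    refine Finset.sum_congr rfl fun x _ => ?_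
    rw [Finset.mul_sum, Finset.mul_sum, Finset.mul_sum]
    refine Finset.sum_congr rfl fun s _ => ?_
    rw [← neg_sub s x, inv_neg]
    ring
  have h3 : -δ / c * (-c * ∑ s ∈ S, v s * (q.eval s / (nodal Y id).eval s)) =
      ∑ s ∈ S, v s * (q.eval s / (δ * (nodal Y id).eval s)) := by
    rw [← mul_assoc, show -δ / c * -c = δ by field_simp, Finset.mul_sum]
    refine Finset.sum_congr rfl fun s hs => ?_
    have := (hδpos s (hSI hs)).ne'
    have hδ0 : δ ≠ 0 := left_ne_zero_of_mul this
    have hn := right_ne_zero_of_mul this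
    field_simp
    linear_combination q.eval s * v s * hδ2
  rw [h1, h3]
  have h4 : ∃ s ∈ S, q.eval s ≠ 0 := by
    by_contra! h
    exact hq (eq_zero_of_degree_lt_of_eval_finset_eq_zero S
      (hdeg.trans_le (by exact_mod_cast hYS)) h)
  obtain ⟨s₀, hs₀, hq₀⟩ := h4
  refine Finset.sum_pos' (fun s hs => mul_nonneg (hv s hs).le
    (div_nonneg (hpos s (hSI hs)) (hδpos s (hSI hs)).le)) ⟨s₀, hs₀, mul_pos (hv s₀ hs₀)
    (div_pos (lt_of_le_of_ne (hpos s₀ (hSI hs₀)) hq₀.symm) (hδpos s₀ (hSI hs₀)))⟩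

/-! ### Zero counting for functions that behave like Stieltjes transforms -/

/-- `m` behaves on `E` like the Stieltjes transform of a measure of constant sign on the
interval `I`. -/
structure StieltjesLike (E I : Set ℝ) (m : ℝ → ℝ) : Prop where
  infinite : E.Infinite
  notMem : ∀ x ∈ E, x ∉ I
  isOpen : IsOpen I
  ordConnected : I.OrdConnected
  pos : ∀ Y : Finset ℝ, (Y : Set ℝ) ⊆ E → StieltjesPos Y I m

theorem StieltjesLike.exists_inv {E I : Set ℝ} {m : ℝ → ℝ} (h : StieltjesLike E I m)
    {Y : Finset ℝ} (hY : (Y : Set ℝ) ⊆ E) :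
    ∃ (ℓ : ℝ[X]) (m' : ℝ → ℝ), ℓ.natDegree ≤ 1 ∧ StieltjesPos Y I m' ∧
      ∀ x ∈ Y, m x ≠ 0 ∧ (m x)⁻¹ = ℓ.eval x + m' x := by
  -- The extra `|Y| + 2` points make `2 * (|Y| + 1)` nodes, hence `|Y| + 1` atoms. The reciprocal
  -- loses one atom and keeps `|Y|`, exactly what `stieltjesPos_discrete` needs.
  obtain ⟨Z, hZE, hZ⟩ := (h.infinite.sdiff Y.finite_toSet).exists_subset_card_eq (Y.card + 2)
  have hdisj : Disjoint Y Z := Finset.disjoint_left.2 fun x hx hz =>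
    (hZE (Finset.mem_coe.2 hz)).2 hx
  have hYZ : ((Y ∪ Z : Finset ℝ) : Set ℝ) ⊆ E := by
    rw [Finset.coe_union]
    exact union_subset hY fun x hx => (hZE hx).1
  obtain ⟨T, w, κ, hTI, hTM, hw, hκ, hmT⟩ := (h.pos _ hYZ).exists_discrete h.ordConnected
    (fun x hx => h.notMem x (hYZ hx)) (M := Y.card + 1) (by omega) (by
      rw [Finset.card_union_of_disjoint hdisj, hZ]; ring)
  obtain ⟨S, v, ℓ, hSI, hSK, hv, hℓ, hinv⟩ := exists_inv_discrete h.ordConnected hTI hTM hw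
  refine ⟨C κ⁻¹ * ℓ, fun x => κ⁻¹ * ∑ s ∈ S, v s * (x - s)⁻¹,
    (natDegree_C_mul_le _ _).trans hℓ,
    stieltjesPos_discrete h.ordConnected (fun x hx => h.notMem x (hY hx)) hSI hSK.ge hv
      (inv_ne_zero hκ), fun x hx => ?_⟩
  obtain ⟨h1, h2⟩ := hinv x (h.notMem x (hY hx))
  rw [hmT x (Finset.mem_union_left _ hx)]
  refine ⟨mul_ne_zero hκ h1, ?_⟩
  rw [mul_inv, h2, eval_mul, eval_C]
  ring

theorem StieltjesLike.ne_zero {E I : Set ℝ} {m : ℝ → ℝ} (h : StieltjesLike E I m) {x : ℝ}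
    (hx : x ∈ E) : m x ≠ 0 := by
  obtain ⟨_, _, _, _, h'⟩ := h.exists_inv (Y := {x}) (by simpa using hx)
  exact (h' x (by simp)).1

/-- Division by `m` turns `A + B m = 0` into `(B + ℓ A) + A m' = 0`, so `A` takes the place of the
coefficient of the transform. The bound on `natDegree A` keeps `ℓ A` below degree `r`. -/
theorem StieltjesLike.exists_isSignSet_left {E I : Set ℝ} {m : ℝ → ℝ} (h : StieltjesLike E I m)
    {Y : Finset ℝ} (hYE : (Y : Set ℝ) ⊆ E) {A B : ℝ[X]} (hA : A ≠ 0)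
    (hY : ∀ x ∈ Y, A.eval x + B.eval x * m x = 0) {r d : ℕ}
    (hAr : A.natDegree + 1 < r) (hBr : B.degree < (r : WithBot ℕ)) (hrd : r + d ≤ Y.card) :
    ∃ S, IsSignSet I (fun x => A.eval x) S ∧ d ≤ S.card := by
  obtain ⟨ℓ, m', hℓ, hpos, hinv⟩ := h.exists_inv hYE
  refine hpos.exists_isSignSet h.ordConnected (A := B + ℓ * A) hA (fun x hx => ?_) (r := r)
    ?_ (degree_lt_of_natDegree_lt (by omega)) hrd
  · obtain ⟨h1, h2⟩ := hinv x hx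
    have h3 := hY x hx
    have h4 : m' x = (m x)⁻¹ - ℓ.eval x := by linarith
    rw [eval_add, eval_mul, h4]
    field_simp
    linarith
  · refine (degree_add_le _ _).trans_lt (max_lt hBr (degree_lt_of_natDegree_lt ?_))
    have := natDegree_mul_le (p := ℓ) (q := A)
    omega

theorem StieltjesLike.exists_isSignSet_right {E I : Set ℝ} {m : ℝ → ℝ} (h : StieltjesLike E I m)
    {Y : Finset ℝ} (hYE : (Y : Set ℝ) ⊆ E) {A B : ℝ[X]} (hB : B ≠ 0)
    (hY : ∀ x ∈ Y, A.eval x + B.eval x * m x = 0) {r d : ℕ}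
    (hAr : A.degree < (r : WithBot ℕ)) (hBr : B.degree < ((r + 1 : ℕ) : WithBot ℕ))
    (hrd : r + d ≤ Y.card) :
    ∃ S, IsSignSet I (fun x => B.eval x) S ∧ d ≤ S.card :=
  (h.pos Y hYE).exists_isSignSet h.ordConnected hB hY hAr hBr hrd

/-- The functions `1, …, x ^ (n₀ - 1), m, …, x ^ (n₁ - 1) m` form a Chebyshev system. -/
theorem StieltjesLike.eq_zero_of_zeros {E I : Set ℝ} {m : ℝ → ℝ} (h : StieltjesLike E I m)
    {Y : Finset ℝ} (hYE : (Y : Set ℝ) ⊆ E) {A B : ℝ[X]}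
    (hY : ∀ x ∈ Y, A.eval x + B.eval x * m x = 0) {a b : ℕ}
    (hA : A.degree < (a : WithBot ℕ)) (hB : B.degree < (b : WithBot ℕ))
    (hab : a + b ≤ Y.card) : A = 0 ∧ B = 0 := by
  have hA' : ∀ p : ℝ[X], ∀ n : ℕ, p ≠ 0 → p.degree < (n : WithBot ℕ) → p.natDegree < n := by
    intro p n hp hn
    rw [degree_eq_natDegree hp] at hn
    exact_mod_cast hn
  by_cases hle : b ≤ a + 1
  -- In either case the chosen component, if nonzero, would have as many sign changes as its strict
  -- degree bound, one more than its degree allows.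
  · have hB0 : B = 0 := by
      by_contra hB0
      obtain ⟨S, hS, hb⟩ := h.exists_isSignSet_right hYE hB0 hY hA
        (hB.trans_le (by exact_mod_cast hle)) hab
      have := hS.card_le_natDegree hB0
      have := hA' B b hB0 hB
      omega
    refine ⟨?_, hB0⟩
    exact eq_zero_of_degree_lt_of_eval_finset_eq_zero Y
      (hA.trans_le (by exact_mod_cast (by omega : a ≤ Y.card)))
      fun x hx => by simpa [hB0] using hY x hx
  · have hA0 : A = 0 := by
      by_contra hA0
      have hn := hA' A a hA0 hA
      obtain ⟨S, hS, hb⟩ := h.exists_isSignSet_left hYE hA0 hY (r := b) (d := a) (by omega) hB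
        (by omega)
      have := hS.card_le_natDegree hA0
      omega
    refine ⟨hA0, ?_⟩
    exact eq_zero_of_degree_lt_of_eval_finset_eq_zero Y
      (hB.trans_le (by exact_mod_cast (by omega : b ≤ Y.card)))
      fun x hx => (mul_eq_zero.1 (by simpa [hA0] using hY x hx)).resolve_right
        (h.ne_zero (hYE hx))

/-! ### Measures of constant sign and their `m`-functions -/

theorem subset_closure_interior_of_nontrivial {V : Set ℝ} (hV : V.OrdConnected)
    (hV' : V.Nontrivial) : V ⊆ closure (interior V) := by
  intro x hx
  obtain ⟨y, hy, hxy⟩ := hV'.exists_ne x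
  have hsub : ∀ a ∈ V, ∀ b ∈ V, closure (Ioo a b) ⊆ closure (interior V) := fun a ha b hb =>
    closure_mono (interior_maximal (Ioo_subset_Icc_self.trans (hV.out ha hb)) isOpen_Ioo)
  rcases lt_or_gt_of_ne hxy with h | h
  · exact hsub y hy x hx (by rw [closure_Ioo h.ne]; exact right_mem_Icc.2 h.le)
  · exact hsub x hx y hy (by rw [closure_Ioo h.ne]; exact left_mem_Icc.2 h.le)

theorem notMem_of_mem_interior {U V : Set ℝ} (hV : V.OrdConnected) (hV' : V.Nontrivial)
    (h : interior U ∩ interior V = ∅) {x : ℝ} (hx : x ∈ interior U) : x ∉ V := by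
  intro hxV
  have hx' := subset_closure_interior_of_nontrivial hV hV' hxV
  obtain ⟨y, hy⟩ := mem_closure_iff.1 hx' _ isOpen_interior hx
  exact (h ▸ hy : y ∈ (∅ : Set ℝ))

theorem ConstSignMeasure.not_ae_mem_finite (σ : ConstSignMeasure) {Z : Set ℝ} (hZ : Z.Finite) :
    ¬ ∀ᵐ t ∂σ.abs, t ∈ Z := fun h =>
  σ.infinite_support (hZ.subset (Measure.support_subset_of_isClosed hZ.isClosed h))

theorem ConstSignMeasure.ae_mem_of_support_subset (σ : ConstSignMeasure) {Γ : Set ℝ}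
    (h : σ.support ⊆ Γ) : ∀ᵐ t ∂σ.abs, t ∈ Γ :=
  Filter.mem_of_superset Measure.support_mem_ae h

theorem ConstSignMeasure.sign_mul_self (σ : ConstSignMeasure) :
    ((σ.sign : ℤ) : ℝ) * ((σ.sign : ℤ) : ℝ) = 1 := by
  rcases Int.units_eq_one_or σ.sign with h | h <;> rw [h] <;> simp

theorem ConstSignMeasure.sign_ne_zero (σ : ConstSignMeasure) : ((σ.sign : ℤ) : ℝ) ≠ 0 :=
  left_ne_zero_of_mul (σ.sign_mul_self ▸ one_ne_zero)

theorem ConstSignMeasure.integrable_eval (σ : ConstSignMeasure) (p : ℝ[X]) :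
    Integrable (fun x => p.eval x) σ.abs := by
  simp_rw [eval_eq_sum_range]
  exact integrable_finsetSum _ fun k _ => (σ.integrable_pow k).const_mul _

theorem abs_inv_sub_le_of_mem_Icc {x y z t : ℝ} (hz : z ∈ Icc x y) (ht : t ∉ Icc x y) :
    |(t - z)⁻¹| ≤ |(t - x)⁻¹| + |(t - y)⁻¹| := by
  rw [abs_inv, abs_inv, abs_inv]
  rw [mem_Icc, not_and_or, not_le, not_le] at ht
  rcases ht with ht | ht
  · have h1 : |t - x| ≤ |t - z| := by
      rw [abs_of_neg (by linarith), abs_of_neg (by linarith [hz.1])]; linarith [hz.1]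
    have h2 : 0 < |t - x| := abs_pos.2 (by linarith)
    have := inv_anti₀ h2 h1
    have h3 : 0 ≤ |t - y|⁻¹ := by positivity
    linarith
  · have h1 : |t - y| ≤ |t - z| := by
      rw [abs_of_pos (by linarith), abs_of_pos (by linarith [hz.2])]; linarith [hz.2]
    have h2 : 0 < |t - y| := abs_pos.2 (by linarith)
    have := inv_anti₀ h2 h1
    have h3 : 0 ≤ |t - x|⁻¹ := by positivity
    linarith

section
variable {τ : ConstSignMeasure} {Γ : Set ℝ}

theorem ConstSignMeasure.MFunctionConverges.ae_ne {x : ℝ} (h : τ.MFunctionConverges x) :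
    ∀ᵐ t ∂τ.abs, t ≠ x := by
  rw [ae_iff]
  simpa using h.1

/-- Only the endpoints `x` and `y` can lie in `Γ`, and convergence there excludes atoms. The kernel
on `[x, y]` is then dominated by its values at the two endpoints, which gives convergence and
continuity of the `m`-function up to a common endpoint of the two intervals. -/
theorem ConstSignMeasure.MFunctionConverges.ae_notMem_Icc {x y : ℝ}
    (hΓ : ∀ᵐ t ∂τ.abs, t ∈ Γ) (hxy : ∀ z ∈ Ioo x y, z ∉ Γ) (hx : τ.MFunctionConverges x)
    (hy : τ.MFunctionConverges y) : ∀ᵐ t ∂τ.abs, t ∉ Icc x y := by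
  filter_upwards [hΓ, hx.ae_ne, hy.ae_ne] with t h1 h2 h3 h4
  exact hxy t ⟨lt_of_le_of_ne h4.1 h2.symm, lt_of_le_of_ne h4.2 h3⟩ h1

theorem ConstSignMeasure.MFunctionConverges.of_mem_Icc {x y z : ℝ}
    (hΓ : ∀ᵐ t ∂τ.abs, t ∈ Γ) (hxy : ∀ z ∈ Ioo x y, z ∉ Γ) (hx : τ.MFunctionConverges x)
    (hy : τ.MFunctionConverges y) (hz : z ∈ Icc x y) : τ.MFunctionConverges z := by
  have h := hx.ae_notMem_Icc hΓ hxy hy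
  constructor
  · have h' : ∀ᵐ t ∂τ.abs, t ≠ z := by
      filter_upwards [h] with t ht htz
      exact ht (htz ▸ hz)
    rw [ae_iff] at h'
    simpa using h'
  · refine (hx.2.abs.add hy.2.abs).mono'
      (measurable_id.sub_const z).inv.aestronglyMeasurable ?_
    filter_upwards [h] with t ht
    exact abs_inv_sub_le_of_mem_Icc hz ht

theorem ConstSignMeasure.MFunctionConverges.continuousOn_mFunction {x y : ℝ}
    (hΓ : ∀ᵐ t ∂τ.abs, t ∈ Γ) (hxy : ∀ z ∈ Ioo x y, z ∉ Γ) (hx : τ.MFunctionConverges x)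
    (hy : τ.MFunctionConverges y) : ContinuousOn τ.mFunction (Icc x y) := by
  have h := hx.ae_notMem_Icc hΓ hxy hy
  refine continuousOn_const.mul (continuousOn_of_dominated
    (bound := fun t => |(t - x)⁻¹| + |(t - y)⁻¹|) ?_ ?_ (hx.2.abs.add hy.2.abs) ?_)
  · exact fun z _ => (measurable_id.sub_const z).inv.aestronglyMeasurable
  · intro z hz
    filter_upwards [h] with t ht
    exact abs_inv_sub_le_of_mem_Icc hz ht
  · filter_upwards [h] with t ht
    refine (continuousOn_const.sub continuousOn_id).inv₀ fun z hz h0 => ht ?_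
    have h1 : t = z := sub_eq_zero.1 h0
    exact h1 ▸ hz

/-- Interchanging sum and integral, the divided difference becomes `∫ q / ω_Y dτ`. The points of `Y`
may be endpoints of `Γ`: signs pass from the interior to `Γ` by continuity, and almost every `t`
avoids `Y`. -/
theorem ConstSignMeasure.stieltjesPos_mFunction (hΓ : ∀ᵐ t ∂τ.abs, t ∈ Γ)
    (hΓc : Γ.OrdConnected) (hΓn : Γ.Nontrivial) {Y : Finset ℝ}
    (hY : ∀ x ∈ Y, τ.MFunctionConverges x) (hYΓ : ∀ x ∈ Y, x ∉ interior Γ) :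
    StieltjesPos Y (interior Γ) τ.mFunction := by
  obtain ⟨δ, hδ, hδpos⟩ := exists_sign_nodal hΓc.interior hYΓ
  have hδ0 : δ ≠ 0 := by rcases hδ with rfl | rfl <;> norm_num
  refine ⟨((τ.sign : ℤ) : ℝ) * δ, fun q hq hdeg hpos => ?_⟩
  have hcl : ∀ f : ℝ[X], (∀ t ∈ interior Γ, 0 ≤ f.eval t) → ∀ t ∈ Γ, 0 ≤ f.eval t :=
    fun f hf t ht => closure_minimal (s := interior Γ) (t := {t | 0 ≤ f.eval t}) hf
      (isClosed_le continuous_const f.continuous)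
      (subset_closure_interior_of_nontrivial hΓc hΓn ht)
  have hYae : ∀ᵐ t ∂τ.abs, t ∉ Y := by
    have : ∀ᵐ t ∂τ.abs, ∀ x ∈ Y, t ≠ x :=
      (Filter.eventually_all_finset Y).2 fun x hx => (hY x hx).ae_ne
    filter_upwards [this] with t ht h using ht t h rfl
  set g : ℝ → ℝ := fun t => ∑ x ∈ Y, nodalWeight Y id x * q.eval x * (t - x)⁻¹ with hg
  have hgi : Integrable g τ.abs :=
    integrable_finsetSum _ fun x hx => (hY x hx).2.const_mul _
  have h1 : dividedDifference Y τ.mFunction q = ((τ.sign : ℤ) : ℝ) * ∫ t, g t ∂τ.abs := by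
    rw [dividedDifference_apply, hg,
      integral_finsetSum _ fun x hx => (hY x hx).2.const_mul _, Finset.mul_sum]
    refine Finset.sum_congr rfl fun x _ => ?_
    rw [integral_const_mul, ConstSignMeasure.mFunction, ConstSignMeasure.integral]
    ring
  have hge : ∀ᵐ t ∂τ.abs, δ * g t = q.eval t / (δ * (nodal Y id).eval t) ∧
      0 < δ * (nodal Y id).eval t := by
    filter_upwards [hYae, hΓ] with t ht htΓ
    have hn := eval_nodal_ne_zero ht
    refine ⟨?_, lt_of_le_of_ne ?_ (mul_ne_zero hδ0 hn).symm⟩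
    · have := eval_eq_eval_nodal_mul_sum hdeg ht
      rw [this, hg]
      have hδ2 : δ * δ = 1 := by rcases hδ with rfl | rfl <;> norm_num
      field_simp
      simp only [sq, hδ2, one_mul]
    · simpa using hcl (C δ * nodal Y id) (fun t ht => by
        simpa using (hδpos t ht).le) t htΓ
  have hnn : 0 ≤ᵐ[τ.abs] fun t => δ * g t := by
    filter_upwards [hge, hΓ] with t ht htΓ
    rw [ht.1]
    exact div_nonneg (hcl q hpos t htΓ) ht.2.le
  -- If the integral were zero, `τ` would be concentrated on the finitely many roots of `q`, against
  -- its infinite support.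
  have h2 : 0 < ∫ t, δ * g t ∂τ.abs := by
    refine lt_of_le_of_ne (integral_nonneg_of_ae hnn) fun h0 => ?_
    have h3 := (integral_eq_zero_iff_of_nonneg_ae hnn (hgi.const_mul δ)).1 h0.symm
    refine τ.not_ae_mem_finite (q.roots.toFinset.finite_toSet) ?_
    filter_upwards [h3, hge] with t h4 h5
    have h6 : q.eval t / (δ * (nodal Y id).eval t) = 0 := by rw [← h5.1]; exact h4
    have h7 := (div_eq_zero_iff.1 h6).resolve_right h5.2.ne'
    simpa [hq] using h7
  rw [integral_const_mul] at h2
  rw [h1]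
  have := τ.sign_mul_self
  calc 0 < δ * ∫ t, g t ∂τ.abs := h2
    _ = ((τ.sign : ℤ) : ℝ) * δ * (((τ.sign : ℤ) : ℝ) * ∫ t, g t ∂τ.abs) := by
      linear_combination (-δ * ∫ t, g t ∂τ.abs) * this

end

/-! ### Reduction of a Nikishin system to one measure and one function -/

/-- What is used of a Nikishin system of two measures: `m` is the `m`-function, `ρ` is the absolute
value of the first measure, and `s` is its sign. -/
structure NikishinData (μ : Fin 2 → ConstSignMeasure) (E I : Set ℝ) (m : ℝ → ℝ) (ρ : Measure ℝ)
    (s : ℝ) : Prop where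
  sign_ne_zero : s ≠ 0
  stieltjesLike : StieltjesLike E I m
  ordConnected : E.OrdConnected
  continuousOn : ∀ x ∈ E, ∀ y ∈ E, ContinuousOn m (Icc x y)
  ae_mem : ∀ᵐ x ∂ρ, x ∈ E
  not_ae_mem_finite : ∀ Z : Set ℝ, Z.Finite → ¬ ∀ᵐ x ∂ρ, x ∈ Z
  integrable : ∀ A B : ℝ[X], Integrable (fun x => A.eval x + B.eval x * m x) ρ
  sum_integral : ∀ A : Fin 2 → ℝ[X],
    ∑ j, (μ j).integral (fun x => (A j).eval x) = s * ∫ x, (A 0).eval x + (A 1).eval x * m x ∂ρ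

/-- A bracket `⟨σ, τ⟩` with `m_τ` of constant sign has the density `|m_τ|`. -/
theorem ConstSignMeasure.IsBracket.integral_eval {μ σ τ : ConstSignMeasure}
    (h : μ.IsBracket σ τ) {ε : ℝ} (hε : ε = 1 ∨ ε = -1)
    (hm : ∀ᵐ x ∂σ.abs, 0 ≤ ε * τ.mFunction x) (p : ℝ[X]) :
    Integrable (fun x => p.eval x * τ.mFunction x) σ.abs ∧
      μ.integral (fun x => p.eval x) =
        ((σ.sign : ℤ) : ℝ) * ∫ x, p.eval x * τ.mFunction x ∂σ.abs := by
  obtain ⟨-, hint, hval⟩ := h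
  have hε2 : ε * ε = 1 := by rcases hε with rfl | rfl <;> norm_num
  set f : ℝ → ENNReal := fun x => ENNReal.ofReal (ε * τ.mFunction x) with hf
  have hmeas : AEMeasurable f σ.abs := (hint.const_mul ε).aemeasurable.ennreal_ofReal
  set ν := σ.abs.withDensity f with hν
  have hfin : IsFiniteMeasure ν := isFiniteMeasure_withDensity_ofReal (hint.const_mul ε).2
  have hμfin := μ.isFiniteMeasure
  have hνr : ∀ B, MeasurableSet B → ν.real B = ε * ∫ x in B, τ.mFunction x ∂σ.abs := by
    intro B hB
    rw [← integral_const_mul, Measure.real, hν, withDensity_apply _ hB,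
      integral_eq_lintegral_of_nonneg_ae (ae_restrict_of_ae hm)
        (hint.const_mul ε).aestronglyMeasurable.restrict]
  have hval' : ∀ B, MeasurableSet B → ((μ.sign : ℤ) : ℝ) * μ.abs.real B =
      ((σ.sign : ℤ) : ℝ) * ε * ν.real B := by
    intro B hB
    have := hval B hB
    rw [ConstSignMeasure.value, ConstSignMeasure.setIntegral] at this
    rw [this, hνr B hB]
    linear_combination (-((σ.sign : ℤ) : ℝ) * ∫ x in B, τ.mFunction x ∂σ.abs) * hε2
  have hne : NeZero μ.abs :=
    ⟨Measure.nonempty_support_iff.1 μ.infinite_support.nonempty⟩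
  have hpos : 0 < μ.abs.real univ := measureReal_univ_pos
  -- The signs are compared through the total mass, which is nonzero because the support is
  -- infinite.
  have hsign : ((μ.sign : ℤ) : ℝ) = ((σ.sign : ℤ) : ℝ) * ε := by
    have h1 := hval' univ MeasurableSet.univ
    have h2 : 0 ≤ ν.real univ := measureReal_nonneg
    rcases Int.units_eq_one_or μ.sign with h3 | h3 <;>
    rcases Int.units_eq_one_or σ.sign with h4 | h4 <;>
    rcases hε with rfl | rfl <;> rw [h3, h4] at h1 ⊢ <;> norm_num at h1 ⊢ <;> linarith
  have hμν : μ.abs = ν := by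
    refine Measure.ext fun B hB => ?_
    have h1 := hval' B hB
    rw [hsign] at h1
    have h2 : μ.abs.real B = ν.real B :=
      mul_left_cancel₀ (by rw [← hsign]; exact μ.sign_ne_zero) h1
    rwa [measureReal_eq_measureReal_iff] at h2
  have htop : ∀ᵐ x ∂σ.abs, f x < ⊤ := Filter.Eventually.of_forall fun x => ENNReal.ofReal_lt_top
  have hcongr : (fun x => (f x).toReal • p.eval x) =ᵐ[σ.abs]
      fun x => ε * (p.eval x * τ.mFunction x) := by
    filter_upwards [hm] with x hx
    rw [hf, ENNReal.toReal_ofReal hx, smul_eq_mul]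
    ring
  constructor
  · have h1 := μ.integrable_eval p
    rw [hμν, hν, integrable_withDensity_iff_integrable_smul₀' hmeas htop,
      integrable_congr hcongr] at h1
    have h2 := h1.const_mul ε
    refine h2.congr (Filter.Eventually.of_forall fun x => ?_)
    simp only
    rw [← mul_assoc, hε2, one_mul]
  · rw [ConstSignMeasure.integral, hμν, hν,
      integral_withDensity_eq_integral_toReal_smul₀ hmeas htop, integral_congr_ae hcongr,
      integral_const_mul, hsign]
    linear_combination (((σ.sign : ℤ) : ℝ) * ∫ x, p.eval x * τ.mFunction x ∂σ.abs) * hε2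

theorem IsNikishinSystem.exists_nikishinData {μ σ : Fin 2 → ConstSignMeasure}
    (hμ : IsNikishinSystem μ σ) : ∃ E I m ρ s, NikishinData μ E I m ρ s := by
  obtain ⟨Γ, hΓ, hdisj, hsupp, h0, hbr⟩ := hμ
  have hnt : ∀ j, (Γ j).Nontrivial := fun j => ((σ j).infinite_support.mono (hsupp j)).nontrivial
  have hae : ∀ j, ∀ᵐ t ∂(σ j).abs, t ∈ Γ j := fun j =>
    (σ j).ae_mem_of_support_subset (hsupp j)
  -- `E` excludes the points where the transform diverges, such as possibly a shared endpoint, yet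
  -- still carries almost all of `σ 0` and remains order-connected.
  set E := {x | x ∈ Γ 0 ∧ (σ 1).MFunctionConverges x} with hE
  have hIoo : ∀ x ∈ E, ∀ y ∈ E, ∀ z ∈ Ioo x y, z ∉ Γ 1 := fun x hx y hy z hz =>
    notMem_of_mem_interior (hΓ 1).2 (hnt 1) hdisj (interior_maximal
      (Ioo_subset_Icc_self.trans ((hΓ 0).2.out hx.1 hy.1)) isOpen_Ioo hz)
  have hEI : ∀ x ∈ E, x ∉ interior (Γ 1) := fun x hx h =>
    notMem_of_mem_interior (hΓ 0).2 (hnt 0) (by rwa [inter_comm]) h hx.1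
  have hEae : ∀ᵐ x ∂(σ 0).abs, x ∈ E := by
    filter_upwards [hae 0, hbr.1] with x h1 h2 using ⟨h1, h2⟩
  have hEoc : E.OrdConnected := ⟨fun x hx y hy z hz => ⟨(hΓ 0).2.out hx.1 hy.1 hz,
    hx.2.of_mem_Icc (hae 1) (hIoo x hx y hy) hy.2 hz⟩⟩
  have hcont : ∀ x ∈ E, ∀ y ∈ E, ContinuousOn (σ 1).mFunction (Icc x y) := fun x hx y hy =>
    hx.2.continuousOn_mFunction (hae 1) (hIoo x hx y hy) hy.2
  have hS : StieltjesLike E (interior (Γ 1)) (σ 1).mFunction :=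
    { infinite := fun h => (σ 0).not_ae_mem_finite h hEae
      notMem := hEI
      isOpen := isOpen_interior
      ordConnected := (hΓ 1).2.interior
      pos := fun Y hY => ConstSignMeasure.stieltjesPos_mFunction (hae 1) (hΓ 1).2 (hnt 1)
        (fun x hx => (hY hx).2) fun x hx => hEI x (hY hx) }
  obtain ⟨ε, hε, hεm⟩ := (HasZeroBetween.of_continuousOn hEoc hcont).exists_sign
    fun x hx => hS.ne_zero hx
  have hint := hbr.integral_eval hε (hEae.mono hεm)
  refine ⟨E, _, _, (σ 0).abs, (((σ 0).sign : ℤ) : ℝ), (σ 0).sign_ne_zero, hS, hEoc, hcont, hEae,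
    fun Z hZ => (σ 0).not_ae_mem_finite hZ,
    fun A B => ((σ 0).integrable_eval A).add (hint B).1, fun A => ?_⟩
  rw [Fin.sum_univ_two, h0, (hint (A 1)).2,
    integral_add ((σ 0).integrable_eval (A 0)) (hint (A 1)).1, ConstSignMeasure.integral]
  ring

namespace NikishinData

variable {μ : Fin 2 → ConstSignMeasure} {E I : Set ℝ} {m : ℝ → ℝ} {ρ : Measure ℝ} {s : ℝ}

/-- With fewer than `N` sign changes, the product of `A + B m` and their nodal polynomial has one
sign and integral zero, so it vanishes almost everywhere. Then `ρ` would live on a finite set. If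
there are infinitely many zeros, any `N` of them will do. -/
theorem exists_zeros (h : NikishinData μ E I m ρ s) {A B : ℝ[X]} {N : ℕ}
    (horth : ∀ k < N, ∫ x, (A.eval x + B.eval x * m x) * x ^ k ∂ρ = 0) :
    ∃ Y : Finset ℝ, (Y : Set ℝ) ⊆ E ∧ Y.card = N ∧ ∀ x ∈ Y, A.eval x + B.eval x * m x = 0 := by
  set F : ℝ → ℝ := fun x => A.eval x + B.eval x * m x with hF
  by_cases hfin : {x ∈ E | F x = 0}.Finite
  · have hz : HasZeroBetween E F := HasZeroBetween.of_continuousOn h.ordConnected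
      fun x hx y hy => A.continuous.continuousOn.add
        (B.continuous.continuousOn.mul (h.continuousOn x hx y hy))
    obtain ⟨S, hSE, hS0, δ, hδ, hsgn⟩ := hz.exists_isSignSet hfin
    by_cases hN : N ≤ S.card
    · obtain ⟨Y, hYS, hY⟩ := Finset.exists_subset_card_eq hN
      exact ⟨Y, fun x hx => hSE (hYS hx), hY, fun x hx => hS0 x (hYS hx)⟩
    · exfalso
      have hδ0 : δ ≠ 0 := by rcases hδ with rfl | rfl <;> norm_num
      have hint : ∀ q : ℝ[X], Integrable (fun x => F x * q.eval x) ρ := fun q => by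
        have := h.integrable (A * q) (B * q)
        refine this.congr (Filter.Eventually.of_forall fun x => ?_)
        simp only [hF, eval_mul]
        ring
      have h1 : ∫ x, F x * (nodal S id).eval x ∂ρ = 0 := by
        have h2 : ∀ x, F x * (nodal S id).eval x =
            ∑ k ∈ Finset.range N, (nodal S id).coeff k * (F x * x ^ k) := by
          intro x
          rw [eval_eq_sum_range' (n := N) (by rw [natDegree_nodal]; omega), Finset.mul_sum]
          exact Finset.sum_congr rfl fun k _ => by ring
        simp_rw [h2]
        rw [integral_finsetSum _ fun k _ => Integrable.const_mul (by
          simpa using hint (X ^ k)) _]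
        refine Finset.sum_eq_zero fun k hk => ?_
        rw [integral_const_mul, horth k (Finset.mem_range.1 hk), mul_zero]
      have hnn : 0 ≤ᵐ[ρ] fun x => δ * (F x * (nodal S id).eval x) := by
        filter_upwards [h.ae_mem] with x hx
        rw [eval_nodal]
        exact hsgn x hx
      have h3 := (integral_eq_zero_iff_of_nonneg_ae hnn ((hint _).const_mul δ)).1 (by
        rw [integral_const_mul, h1, mul_zero])
      refine h.not_ae_mem_finite _ hfin ?_
      filter_upwards [h3, h.ae_mem] with x h4 hx
      refine ⟨hx, ?_⟩
      rcases mul_eq_zero.1 ((mul_eq_zero.1 h4).resolve_left hδ0) with h5 | h5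
      · exact h5
      · by_contra h6
        exact eval_nodal_ne_zero (fun hxS => h6 (hS0 x hxS)) h5
  · obtain ⟨Y, hY, hYc⟩ := Set.Infinite.exists_subset_card_eq hfin N
    exact ⟨Y, fun x hx => (hY hx).1, hYc, fun x hx => (hY hx).2⟩

end NikishinData

/-! ### Moments, type I vectors and their linear combinations -/

theorem ConstSignMeasure.integrable_eval_mul_pow (σ : ConstSignMeasure) (p : ℝ[X]) (k : ℕ) :
    Integrable (fun x => p.eval x * x ^ k) σ.abs := by
  refine (σ.integrable_eval (p * X ^ k)).congr (Filter.Eventually.of_forall fun x => ?_)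
  simp

/-- The `k`-th moment of a vector of polynomials with respect to a vector of measures. -/
noncomputable def vectorMoment {r : ℕ} (μ : Fin r → ConstSignMeasure) (k : ℕ) :
    (Fin r → ℝ[X]) →ₗ[ℝ] ℝ where
  toFun A := ∑ j, (μ j).integral (fun x => (A j).eval x * x ^ k)
  map_add' A B := by
    rw [← Finset.sum_add_distrib]
    refine Finset.sum_congr rfl fun j _ => ?_
    simp only [ConstSignMeasure.integral, Pi.add_apply, eval_add, add_mul]
    rw [integral_add ((μ j).integrable_eval_mul_pow _ k) ((μ j).integrable_eval_mul_pow _ k),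
      mul_add]
  map_smul' c A := by
    rw [RingHom.id_apply, smul_eq_mul, Finset.mul_sum]
    refine Finset.sum_congr rfl fun j _ => ?_
    simp only [ConstSignMeasure.integral, Pi.smul_apply, eval_smul, smul_eq_mul, mul_assoc]
    rw [integral_const_mul]
    ring

namespace NikishinData

variable {μ : Fin 2 → ConstSignMeasure} {E I : Set ℝ} {m : ℝ → ℝ} {ρ : Measure ℝ} {s : ℝ}

theorem vectorMoment_eq (h : NikishinData μ E I m ρ s) (A : Fin 2 → ℝ[X]) (k : ℕ) :
    vectorMoment μ k A = s * ∫ x, ((A 0).eval x + (A 1).eval x * m x) * x ^ k ∂ρ := by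
  have h1 := h.sum_integral fun j => A j * X ^ k
  simp only [eval_mul, eval_pow, eval_X] at h1
  refine h1.trans ?_
  congr 2
  ext x
  ring

theorem exists_zeros_of_moments (h : NikishinData μ E I m ρ s) {A : Fin 2 → ℝ[X]} {N : ℕ}
    (horth : ∀ k < N, vectorMoment μ k A = 0) :
    ∃ Y : Finset ℝ, (Y : Set ℝ) ⊆ E ∧ Y.card = N ∧
      ∀ x ∈ Y, (A 0).eval x + (A 1).eval x * m x = 0 :=
  h.exists_zeros fun k hk =>
    (mul_eq_zero.1 ((h.vectorMoment_eq A k).symm.trans (horth k hk))).resolve_left h.sign_ne_zero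

theorem eq_zero_of_moments (h : NikishinData μ E I m ρ s) {A : Fin 2 → ℝ[X]} {n : Fin 2 → ℕ}
    {N : ℕ} (hdeg : ∀ j, (A j).degree < (n j : WithBot ℕ))
    (horth : ∀ k < N, vectorMoment μ k A = 0) (hn : n 0 + n 1 ≤ N) : A = 0 := by
  obtain ⟨Y, hYE, hYc, hY⟩ := h.exists_zeros_of_moments horth
  obtain ⟨h0, h1⟩ := h.stieltjesLike.eq_zero_of_zeros hYE hY (hdeg 0) (hdeg 1) (hYc ▸ hn)
  ext1 j
  fin_cases j
  · exact h0
  · exact h1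

/-- If `A i` vanished, `n i` could be replaced by `0`, and the vanishing moments would then be at
least as many as the free coefficients. -/
theorem component_ne_zero (h : NikishinData μ E I m ρ s) {A : Fin 2 → ℝ[X]} {n : Fin 2 → ℕ}
    {N : ℕ} (hA : A ≠ 0) (hdeg : ∀ j, (A j).degree < (n j : WithBot ℕ))
    (horth : ∀ k < N, vectorMoment μ k A = 0) {i : Fin 2} (hn : n 0 + n 1 ≤ N + n i) :
    A i ≠ 0 := by
  intro hi
  refine hA (h.eq_zero_of_moments (n := Function.update n i 0) (fun j => ?_) horth ?_)
  · by_cases hj : j = i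
    · subst hj
      rw [hi, degree_zero]
      exact WithBot.bot_lt_coe _
    · rw [Function.update_of_ne hj]
      exact hdeg j
  · fin_cases i <;> simp at hn ⊢ <;> omega

/-- The `N` zeros in `E` give `n i - 2` sign changes of `A i` in `I`, one less than the largest
possible degree. The inequality between `n 0` and `n 1` is what the sign count for the component `i`
requires. -/
theorem hasRealSimpleZeros (h : NikishinData μ E I m ρ s) {A : Fin 2 → ℝ[X]} {n : Fin 2 → ℕ}
    {N : ℕ} (hA : A ≠ 0) (hdeg : ∀ j, (A j).degree < (n j : WithBot ℕ))
    (horth : ∀ k < N, vectorMoment μ k A = 0) (hN : N + 2 = n 0 + n 1) {i : Fin 2}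
    (hi : 2 ≤ n i) (hi0 : i = 0 → n 0 + 1 ≤ n 1) (hi1 : i = 1 → n 1 ≤ n 0 + 1) :
    HasRealSimpleZeros (A i) := by
  have hAi := h.component_ne_zero (i := i) hA hdeg horth (by omega)
  have hnat : (A i).natDegree < n i := by
    have := hdeg i
    rw [degree_eq_natDegree hAi] at this
    exact_mod_cast this
  obtain ⟨Y, hYE, hYc, hY⟩ := h.exists_zeros_of_moments horth
  obtain ⟨S, hS, hd⟩ : ∃ S, IsSignSet I (fun x => (A i).eval x) S ∧ n i - 2 ≤ S.card := by
    rcases Fin.exists_fin_two.1 ⟨i, rfl⟩ with rfl | rfl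
    · have := hi0 rfl
      exact h.stieltjesLike.exists_isSignSet_left hYE hAi hY (r := n 1) (by omega) (hdeg 1)
        (by omega)
    · have := hi1 rfl
      exact h.stieltjesLike.exists_isSignSet_right hYE hAi hY (r := n 0) (hdeg 0)
        ((hdeg 1).trans_le (by exact_mod_cast this)) (by omega)
  exact hS.hasRealSimpleZeros h.stieltjesLike.isOpen hAi hd (by omega)

/-- The first `|n|` moments form a linear map between spaces of the same dimension `|n|`; it is
injective by `eq_zero_of_moments`, hence bijective. -/
theorem existsUnique_isTypeI (h : NikishinData μ E I m ρ s) {n : Fin 2 → ℕ} (hn : n ≠ 0) :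
    ∃! A : Fin 2 → ℝ[X], IsTypeI μ n A := by
  have hpos : 0 < ∑ j, n j := by
    by_contra! h0
    apply hn
    ext j
    have := Finset.single_le_sum (f := n) (fun _ _ => Nat.zero_le _) (Finset.mem_univ j)
    simp only [Pi.zero_apply]
    omega
  let ι : (∀ j, degreeLT ℝ (n j)) →ₗ[ℝ] (Fin 2 → ℝ[X]) :=
    LinearMap.pi fun j => (degreeLT ℝ (n j)).subtype ∘ₗ LinearMap.proj j
  let φ : (∀ j, degreeLT ℝ (n j)) →ₗ[ℝ] (Fin (∑ j, n j) → ℝ) :=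
    LinearMap.pi fun k => vectorMoment μ k ∘ₗ ι
  have hfin : ∀ j, FiniteDimensional ℝ (degreeLT ℝ (n j)) := fun j =>
    Module.Finite.equiv (degreeLTEquiv ℝ (n j)).symm
  have hrank : Module.finrank ℝ (∀ j, degreeLT ℝ (n j)) =
      Module.finrank ℝ (Fin (∑ j, n j) → ℝ) := by
    rw [Module.finrank_pi_fintype, Module.finrank_fin_fun]
    exact Finset.sum_congr rfl fun j _ => by
      rw [(degreeLTEquiv ℝ (n j)).finrank_eq, Module.finrank_fin_fun]
  have hinj : Function.Injective φ := by
    rw [← LinearMap.ker_eq_bot, LinearMap.ker_eq_bot']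
    intro A hA
    have := h.eq_zero_of_moments (A := ι A) (n := n) (N := ∑ j, n j)
      (fun j => mem_degreeLT.1 (A j).2) (fun k hk => congrFun hA ⟨k, hk⟩)
      (by rw [Fin.sum_univ_two])
    ext1 j
    exact Subtype.ext (congrFun this j)
  obtain ⟨A, hA⟩ := (LinearMap.injective_iff_surjective_of_finrank_eq_finrank hrank).1 hinj
    fun k => if (k : ℕ) + 1 = ∑ j, n j then 1 else 0
  have hmom : ∀ k < ∑ j, n j, vectorMoment μ k (ι A) = if k + 1 = ∑ j, n j then 1 else 0 :=
    fun k hk => congrFun hA ⟨k, hk⟩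
  refine ⟨ι A, ⟨?_, fun j => mem_degreeLT.1 (A j).2, fun k hk => ?_, fun k hk => ?_⟩, ?_⟩
  · intro h0
    have := hmom ((∑ j, n j) - 1) (by omega)
    rw [h0, map_zero, if_pos (by omega)] at this
    exact zero_ne_one this
  · exact (hmom k (by omega)).trans (if_neg (by omega))
  · exact (hmom k (by omega)).trans (if_pos hk)
  · rintro B ⟨-, hBdeg, hB0, hB1⟩
    refine sub_eq_zero.1 (h.eq_zero_of_moments (A := B - ι A) (n := n) (N := ∑ j, n j)
      (fun j => ?_) (fun k hk => ?_) (by rw [Fin.sum_univ_two]))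
    · exact (degree_sub_le _ _).trans_lt (max_lt (hBdeg j) (mem_degreeLT.1 (A j).2))
    · rw [map_sub, hmom k hk, sub_eq_zero]
      by_cases hk1 : k + 1 = ∑ j, n j
      · rw [if_pos hk1]
        exact hB1 k hk1
      · rw [if_neg hk1]
        exact hB0 k (by omega)

/-- The normalising moment of the lower index decides. If one index is `n`, its vector has that
moment zero, so the other coefficient vanishes. If both are lower neighbours, both moments equal
`1`, so a vanishing combination would force `A = B`. -/
theorem smul_add_smul_ne_zero (h : NikishinData μ E I m ρ s) {n k l : Fin 2 → ℕ}
    (hk : k ∈ lowerNeighbours n) (hl : l ∈ lowerNeighbours n) (hkl : k ≠ l)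
    {A B : Fin 2 → ℝ[X]} (hA : IsTypeI μ k A) (hB : IsTypeI μ l B)
    (hk0 : 0 < ∑ j, k j) (hl0 : 0 < ∑ j, l j) {a b : ℝ} (hab : a ≠ 0 ∨ b ≠ 0) :
    a • A + b • B ≠ 0 := by
  have key : ∀ {l : Fin 2 → ℕ} {A B : Fin 2 → ℝ[X]} {a b : ℝ}, IsTypeI μ n A → IsTypeI μ l B →
      (∃ j, l + Pi.single j 1 = n) → 0 < ∑ j, l j → (a ≠ 0 ∨ b ≠ 0) → a • A + b • B ≠ 0 := by
    rintro l A B a b hA hB ⟨j, rfl⟩ hl0 hab h0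
    have hsum : ∑ i, (l + Pi.single j 1 : Fin 2 → ℕ) i = (∑ i, l i) + 1 := by
      simp [Finset.sum_add_distrib]
    have h1 := congrArg (vectorMoment μ ((∑ i, l i) - 1)) h0
    have hA' : vectorMoment μ ((∑ i, l i) - 1) A = 0 := hA.2.2.1 _ (by omega)
    have hB' : vectorMoment μ ((∑ i, l i) - 1) B = 1 := hB.2.2.2 _ (by omega)
    rw [map_add, map_smul, map_smul, hA', hB', map_zero] at h1
    have hb : b = 0 := by simpa using h1
    subst hb
    rw [zero_smul, add_zero, smul_eq_zero] at h0
    exact h0.elim (by simpa using hab) hA.1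
  rcases hk with rfl | hk
  · rcases hl with rfl | hl
    · exact absurd rfl hkl
    · exact key hA hB hl hl0 hab
  · rcases hl with rfl | hl
    · rw [add_comm]
      exact key hB hA hk hk0 hab.symm
    · obtain ⟨i, hi⟩ := hk
      obtain ⟨j, hj⟩ := hl
      intro h0
      have hks : (∑ i, k i) + 1 = ∑ i, n i := by
        rw [← hi]; simp [Finset.sum_add_distrib]
      have hls : (∑ i, l i) + 1 = ∑ i, n i := by
        rw [← hj]; simp [Finset.sum_add_distrib]
      have h1 := congrArg (vectorMoment μ ((∑ i, l i) - 1)) h0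
      have hA' : vectorMoment μ ((∑ i, l i) - 1) A = 1 := hA.2.2.2 _ (by omega)
      have hB' : vectorMoment μ ((∑ i, l i) - 1) B = 1 := hB.2.2.2 _ (by omega)
      rw [map_add, map_smul, map_smul, hA', hB', map_zero] at h1
      have hb : b = -a := by simp at h1; linarith
      subst hb
      have ha : a ≠ 0 := by simpa using hab
      have hAB : A = B := by
        rw [neg_smul, ← sub_eq_add_neg, ← smul_sub, smul_eq_zero] at h0
        exact sub_eq_zero.1 (h0.resolve_left ha)
      subst hAB
      have hij : i ≠ j := by
        rintro rfl
        exact hkl (add_right_cancel (hi.trans hj.symm))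
      -- A common vector obeys both degree bounds, which leaves `|n| - 2` coefficients against `|k|
      -- - 1 = |n| - 2` vanishing moments.
      refine hA.1 (h.eq_zero_of_moments (n := fun j => min (k j) (l j)) (N := (∑ i, k i) - 1)
        (fun j => ?_) (fun t ht => hA.2.2.1 t (by omega)) ?_)
      · rcases min_choice (k j) (l j) with h' | h' <;> rw [h']
        · exact hA.2.1 j
        · exact hB.2.1 j
      · have e0 := congrFun (hi.trans hj.symm) 0
        have e1 := congrFun (hi.trans hj.symm) 1
        rw [Fin.sum_univ_two]
        fin_cases i <;> fin_cases j <;> simp at e0 e1 hij ⊢ <;> omega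

theorem typeIPairwiseInterlace (h : NikishinData μ E I m ρ s) {n : Fin 2 → ℕ} {i : Fin 2}
    (hi0 : i = 0 → n 0 + 1 ≤ n 1) (hi1 : i = 1 → n 1 ≤ n 0 + 1) :
    TypeIPairwiseInterlace μ n i := by
  intro k hk l hl hkl hki hli A B hA hB
  have hle : ∀ {k : Fin 2 → ℕ}, k ∈ lowerNeighbours n →
      (∀ j, k j ≤ n j) ∧ n 0 + n 1 ≤ k 0 + k 1 + 1 := by
    rintro k (rfl | ⟨j, rfl⟩)
    · exact ⟨fun _ => le_rfl, by omega⟩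
    · refine ⟨fun _ => Nat.le_add_right _ _, ?_⟩
      fin_cases j <;> simp <;> omega
  obtain ⟨hkn, hks⟩ := hle hk
  obtain ⟨hln, hls⟩ := hle hl
  by_cases hi : 2 ≤ n i
  · refine interlace_of_forall_combination fun a b hab => ?_
    have hk0 : 0 < ∑ j, k j := lt_of_lt_of_le (Nat.pos_of_ne_zero hki)
      (Finset.single_le_sum (fun _ _ => Nat.zero_le _) (Finset.mem_univ i))
    have hl0 : 0 < ∑ j, l j := lt_of_lt_of_le (Nat.pos_of_ne_zero hli)
      (Finset.single_le_sum (fun _ _ => Nat.zero_le _) (Finset.mem_univ i))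
    have hG := h.smul_add_smul_ne_zero hk hl hkl hA hB hk0 hl0 hab
    have hni : n i ≤ n 0 + n 1 := by
      rcases Fin.exists_fin_two.1 ⟨i, rfl⟩ with rfl | rfl <;> omega
    have := h.hasRealSimpleZeros (n := n) (N := n 0 + n 1 - 2) (i := i) hG (fun j => ?_)
      (fun t ht => ?_) (by omega) hi hi0 hi1
    · simpa [smul_eq_C_mul] using this
    · refine (degree_add_le _ _).trans_lt (max_lt ?_ ?_)
      · exact (degree_smul_le _ _).trans_lt ((hA.2.1 j).trans_le (by exact_mod_cast hkn j))
      · exact (degree_smul_le _ _).trans_lt ((hB.2.1 j).trans_le (by exact_mod_cast hln j))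
    · have hA' : vectorMoment μ t A = 0 := hA.2.2.1 t (by rw [Fin.sum_univ_two]; omega)
      have hB' : vectorMoment μ t B = 0 := hB.2.2.1 t (by rw [Fin.sum_univ_two]; omega)
      rw [map_add, map_smul, map_smul, hA', hB', smul_zero, smul_zero, add_zero]
  -- Here `n i = 1`, so both components are nonzero constants. They are treated apart because a
  -- nontrivial combination of two constants can be zero.
  · have hconst : ∀ {k : Fin 2 → ℕ} {A : Fin 2 → ℝ[X]}, k i ≠ 0 → k i ≤ n i → IsTypeI μ k A →
        ∃ a : ℝ, a ≠ 0 ∧ A i = C a := by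
      intro k A hki hkn hA
      have hne := h.component_ne_zero (N := k 0 + k 1 - 1) (i := i) hA.1 hA.2.1
        (fun t ht => hA.2.2.1 t (by rw [Fin.sum_univ_two]; omega)) (by omega)
      have hd : (A i).natDegree < k i := by
        have := hA.2.1 i
        rw [degree_eq_natDegree hne] at this
        exact_mod_cast this
      obtain ⟨a, ha⟩ := natDegree_eq_zero.1 (by omega : (A i).natDegree = 0)
      refine ⟨a, ?_, ha.symm⟩
      rintro rfl
      rw [map_zero] at ha
      exact hne ha.symm
    obtain ⟨a, ha, hAa⟩ := hconst hki (hkn i) hA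
    obtain ⟨b, hb, hBb⟩ := hconst hli (hln i) hB
    rw [hAa, hBb]
    exact interlace_C ha hb

end NikishinData

theorem mainTheorem6 (μ σ : Fin 2 → ConstSignMeasure) (hμ : IsNikishinSystem μ σ) :
    (∀ n : Fin 2 → ℕ, n ≠ 0 → ∃! A : Fin 2 → ℝ[X], IsTypeI μ n A) ∧
    (∀ n : Fin 2 → ℕ, n 0 + 1 ≤ n 1 → TypeIPairwiseInterlace μ n 0) ∧
    (∀ n : Fin 2 → ℕ, n 0 + 1 ≥ n 1 → TypeIPairwiseInterlace μ n 1) := by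
  obtain ⟨E, I, m, ρ, s, h⟩ := hμ.exists_nikishinData
  exact ⟨fun n hn => h.existsUnique_isTypeI hn,
    fun n hn => h.typeIPairwiseInterlace (fun _ => hn) (fun h => by simp at h),
    fun n hn => h.typeIPairwiseInterlace (fun h => by simp at h) (fun _ => hn)⟩
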